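/- Let $G$ be a second-countable, locally compact (Hausdorff), unimodular, amenable group with Haar measure $\mu$, and fix a compact symmetric neighborhood $Q$ of the identity. Here $G$ is amenable if it admits a Følner sequence, i.e. a sequence $(K_n)$ of compact sets with $\mu(K_n)>0$ and $\mu(K_nC\,\Delta\,K_n)/\mu(K_n)\to 0$ for every non-empty compact $C\subseteq G$; the sequence is strong Følner if moreover $\mu(K_nC\cap K_n^cC)/\mu(K_n)\to 0$ for every compact $C\subseteq G$. Let $(\pi,\mathcal H_\pi)$ be a discrete series representation of $G$: a strongly measurable map $\pi$ from $G$ to the unitary operators of a complex Hilbert space with $\pi(xy)=\sigma(x,y)\pi(x)\pi(y)$ for some $\sigma:G\times G\to\mathbb T$, having no closed invariant subspaces except $\{0\}$ and $\mathcal H_\pi$, and such that $\int_G|\langle g,\pi(x)g\rangle|^2\,d\mu(x)<\infty$ for some $g\neq0$. Its formal degree is the number $d_\pi>0$ with $$\int_G\langle f_1,\pi(x)g_1\rangle\langle\pi(x)g_2,f_2\rangle\,d\mu(x)=d_\pi^{-1}\langle f_1,f_2\rangle\overline{\langle g_1,g_2\rangle}\qquad\text{for all } f_1,f_2,g_1,g_2\in\mathcal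 H_\pi .$$ Let $\mathcal B^2_\pi$ be the set of all $g\in\mathcal H_\pi$ such that $V_gg(x)=\langle g,\pi(x)g\rangle$ is locally essentially bounded and $x\mapsto\operatorname{ess\,sup}_{z\in Q}|V_gg(xz)|$ belongs to $L^2(G)$. For a discrete set $\Lambda\subseteq G$, let $$D^-(\Lambda)=\lim_{n\to\infty}\inf_{x\in G}\frac{\#(\Lambda\cap xK_n)}{\mu(K_n)},\qquad D^+(\Lambda)=\lim_{n\to\infty}\sup_{x\in G}\frac{\#(\Lambda\cap xK_n)}{\mu(K_n)},$$ where $(K_n)$ is any strong Følner sequence. The family $\pi(\Lambda)g=(\pi(\lambda)g)_{\lambda\in\Lambda}$ is a frame if there are $A,B>0$ with $A\|f\|^2\le\sum_{\lambda\in\Lambda}|\langle f,\pi(\lambda)g\rangle|^2\le B\|f\|^2$ for all $f\in\mathcal H_\pi$, and a Riesz basis if it is a frame that ceases to be a frame after the removal of an arbitrary element. Let $\Lambda\subseteq G$ be discrete and $g\in\mathcal B^2_\pi$. If $\pi(\Lambda)g$ is a frame for $\mathcal H_\pi$, then the limit $D^-(\Lambda)$ exists, does not depend on the strong Følner sequence,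 and satisfies $D^-(\Lambda)\ge d_\pi$. If $\pi(\Lambda)g$ is a Riesz basis for $\mathcal H_\pi$, then the limit $D^+(\Lambda)$ exists for every strong Følner sequence, and $D^+(\Lambda)=d_\pi$. -/

import Mathlib

open Filter Topology MeasureTheory
open scoped ENNReal Pointwise

noncomputable section

namespace CoherentFrames

section Group

variable {G : Type*} [Group G] [TopologicalSpace G] [MeasurableSpace G]

/-- A (right) Følner sequence of non-null compact sets. The test sets `C` are non-empty
(for `C = ∅` the quotient would be constantly `1`). -/
structure IsFolner (μ : Measure G) (K : ℕ → Set G) : Prop where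
  isCompact : ∀ n, IsCompact (K n)
  measure_ne_zero : ∀ n, μ (K n) ≠ 0
  tendsto_symmDiff : ∀ C : Set G, IsCompact C → C.Nonempty →
    Tendsto (fun n => μ (symmDiff (K n * C) (K n)) / μ (K n)) atTop (𝓝 0)

/-- A (right) strong Følner sequence. -/
structure IsStrongFolner (μ : Measure G) (K : ℕ → Set G) : Prop extends IsFolner μ K where
  tendsto_boundary : ∀ C : Set G, IsCompact C →
    Tendsto (fun n => μ ((K n * C) ∩ ((K n)ᶜ * C)) / μ (K n)) atTop (𝓝 0)

/-- Amenability: existence of a Følner sequence. -/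
def IsAmenable (μ : Measure G) : Prop :=
  ∃ K : ℕ → Set G, IsFolner μ K

/-- The quotient `#(Λ ∩ x K) / μ(K)`. -/
def countRatio (μ : Measure G) (Λ K : Set G) (x : G) : ℝ≥0∞ :=
  ((Λ ∩ x • K).encard : ℝ≥0∞) / μ K

/-- `D` is the lower Beurling density of `Λ`: along every strong Følner sequence the limit
defining the density exists, and it equals `D`. -/
def HasLowerBeurlingDensity (μ : Measure G) (Λ : Set G) (D : ℝ≥0∞) : Prop :=
  ∀ K : ℕ → Set G, IsStrongFolner μ K →
    Tendsto (fun n => ⨅ x : G, countRatio μ Λ (K n) x) atTop (𝓝 D)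

/-- `D` is the upper Beurling density of `Λ`: along every strong Følner sequence the limit
defining the density exists, and it equals `D`. -/
def HasUpperBeurlingDensity (μ : Measure G) (Λ : Set G) (D : ℝ≥0∞) : Prop :=
  ∀ K : ℕ → Set G, IsStrongFolner μ K →
    Tendsto (fun n => ⨆ x : G, countRatio μ Λ (K n) x) atTop (𝓝 D)

/-- The left-sided local maximal function `x ↦ ess sup_{z ∈ Q} |F (x z)|`. -/
def localMaximal (μ : Measure G) (Q : Set G) (F : G → ℂ) (x : G) : ℝ≥0∞ :=
  essSup (fun z => ‖F (x * z)‖ₑ) (μ.restrict Q)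

/-- Membership in the left-sided Wiener amalgam space `W^L(L^p)`: `F` is measurable and locally
essentially bounded, and its local maximal function is in `L^p`. -/
structure MemWienerAmalgam (μ : Measure G) (Q : Set G) (p : ℝ≥0∞) (F : G → ℂ) : Prop where
  aestronglyMeasurable : AEStronglyMeasurable F μ
  locallyBounded : ∀ C : Set G, IsCompact C → essSup (fun x => ‖F x‖ₑ) (μ.restrict C) < ∞
  memLp : MemLp (localMaximal μ Q F) p μ

end Group

section Frames

variable {H : Type*} [NormedAddCommGroup H] [InnerProductSpace ℂ H] {ι : Type*}

/-- The frame inequalities for a family of vectors in a Hilbert space. -/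
def IsFrame (φ : ι → H) : Prop :=
  ∃ A B : ℝ, 0 < A ∧ 0 < B ∧ ∀ f : H,
    Summable (fun i => ‖inner ℂ (φ i) f‖ ^ 2) ∧
    A * ‖f‖ ^ 2 ≤ ∑' i, ‖inner ℂ (φ i) f‖ ^ 2 ∧
    ∑' i, ‖inner ℂ (φ i) f‖ ^ 2 ≤ B * ‖f‖ ^ 2

/-- A Riesz basis, i.e. an exact frame: a frame that ceases to be a frame after the removal of
an arbitrary element. -/
def IsRieszBasis (φ : ι → H) : Prop :=
  IsFrame φ ∧ ∀ j : ι, ¬ IsFrame (fun i : {i : ι // i ≠ j} => φ i)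

end Frames

section Representations

variable {G : Type*} [Group G] [TopologicalSpace G] [MeasurableSpace G]
variable {H : Type*} [NormedAddCommGroup H] [InnerProductSpace ℂ H]

/-- A projective unitary representation: a strongly measurable map into the unitary operators
that is multiplicative up to a phase. -/
structure IsProjectiveRep (π : G → H ≃ₗᵢ[ℂ] H) : Prop where
  stronglyMeasurable : ∀ f : H, StronglyMeasurable (fun x => π x f)
  exists_cocycle : ∃ σ : G → G → Circle, ∀ (x y : G) (f : H),
    π (x * y) f = (σ x y : ℂ) • π x (π y f)

/-- The coefficient `V_g f (x) = ⟨f, π(x) g⟩`. Mathlib's inner product is linear in the second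
argument, so the inner product `⟨u, v⟩` that is linear in `u` is `inner ℂ v u`. -/
def coeff (π : G → H ≃ₗᵢ[ℂ] H) (g f : H) (x : G) : ℂ :=
  inner ℂ (π x g) f

/-- Irreducibility: there are no non-trivial closed invariant subspaces. -/
def IsIrreducible (π : G → H ≃ₗᵢ[ℂ] H) : Prop :=
  ∀ W : Submodule ℂ H, IsClosed (W : Set H) → (∀ x : G, ∀ f ∈ W, π x f ∈ W) → W = ⊥ ∨ W = ⊤

/-- A discrete series representation: a projective unitary representation that is irreducible
and square-integrable. -/
structure IsDiscreteSeries (μ : Measure G) (π : G → H ≃ₗᵢ[ℂ] H) : Prop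
    extends IsProjectiveRep π where
  irreducible : IsIrreducible π
  squareIntegrable : ∃ g : H, g ≠ 0 ∧ ∫⁻ x, ‖coeff π g g x‖ₑ ^ 2 ∂μ < ∞

/-- `d` is the formal degree of `π`: the positive number in the orthogonality relations
`∫ ⟨f₁, π(x) g₁⟩ ⟨π(x) g₂, f₂⟩ dμ(x) = d⁻¹ ⟨f₁, f₂⟩ conj ⟨g₁, g₂⟩`. -/
def IsFormalDegree (μ : Measure G) (π : G → H ≃ₗᵢ[ℂ] H) (d : ℝ) : Prop :=
  0 < d ∧ ∀ f₁ f₂ g₁ g₂ : H,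
    Integrable (fun x => coeff π g₁ f₁ x * inner ℂ f₂ (π x g₂)) μ ∧
    ∫ x, coeff π g₁ f₁ x * inner ℂ f₂ (π x g₂) ∂μ =
      (d : ℂ)⁻¹ * inner ℂ f₂ f₁ * (starRingEnd ℂ) (inner ℂ g₂ g₁)

/-- The space `B^2_π` of all `g` with `V_g g ∈ W^L(L^2)`. -/
def B2 (μ : Measure G) (Q : Set G) (π : G → H ≃ₗᵢ[ℂ] H) : Set H :=
  {g | MemWienerAmalgam μ Q 2 (coeff π g g)}

/-- The coherent system `(π(l) g)_{l ∈ Λ}`. -/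
def coherentSystem (π : G → H ≃ₗᵢ[ℂ] H) (Λ : Set G) (g : H) : Λ → H :=
  fun l => π l g

end Representations

end CoherentFrames

end

/-! For a finite-dimensional subspace `W` with orthogonal projection `P`, the orthogonality
relations give `∫ ‖P π(y)g‖² dμ(y) = dim W · ‖g‖² / d`. Both density bounds come from choosing `W`
well.

For a frame, let `W` be spanned by the dual vectors indexed by `Λ ∩ xKC`. Since `g ∈ B2` and `Λ` is
relatively separated, the frame coefficients of `π(y)g` are uniformly small away from `y`. So for `y
∈ xK` the integrand is at least `(1 - ε)‖g‖²`, whence `d(1 - ε) μ(K) ≤ #(Λ ∩ xKC)`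
(`exists_le_encard_of_isFrame`). For a Riesz basis, let `W` be spanned by finitely many `π(l)g` with
`l ∈ Λ ∩ xK`; these are independent, the integrand is at most `‖g‖²` on `xKC`, and the lower Riesz
bound makes the rest of the integral small, whence `#(Λ ∩ xK) ≤ d(1 + ε) μ(KC)`
(`exists_encard_le_of_isRieszBasis`). The Følner property removes `C`.

The lower density exists because averaging over translates makes the infimum along a strong Følner
sequence asymptotically dominate that of any fixed compact set: the limit is a supremum
(`hasLowerBeurlingDensity_lowerDensity`). The upper density is squeezed between the lower density
and `d`. The formal degree itself comes from Schur's lemma applied to the graph of `f ↦ V_g f`. -/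

set_option linter.unusedSectionVars false

namespace CoherentFrames

/-! ### Phase-independent identities for coefficients. -/

section RepresentationBasics

variable {G : Type*} [Group G] [TopologicalSpace G] [MeasurableSpace G]
variable {H : Type*} [NormedAddCommGroup H] [InnerProductSpace ℂ H]
variable {π : G → H ≃ₗᵢ[ℂ] H}

lemma IsProjectiveRep.exists_one (hπ : IsProjectiveRep π) :
    ∃ c : Circle, ∀ f, π 1 f = (c : ℂ) • f := by
  obtain ⟨σ, hσ⟩ := hπ.exists_cocycle
  refine ⟨(σ 1 1)⁻¹, fun f => ?_⟩
  have h := hσ 1 1 f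
  rw [mul_one, ← map_smul] at h
  have h2 : f = (σ 1 1 : ℂ) • π 1 f := (π 1).injective h
  conv_rhs => rw [h2]
  rw [smul_smul, ← Circle.coe_mul]
  simp

lemma IsProjectiveRep.norm_inner_mul (hπ : IsProjectiveRep π) (y z : G) (a b : H) :
    ‖inner ℂ (π (y * z) a) (π y b)‖ = ‖inner ℂ (π z a) b‖ := by
  obtain ⟨σ, hσ⟩ := hπ.exists_cocycle
  rw [hσ, inner_smul_left, LinearIsometryEquiv.inner_map_map]
  simp [Circle.norm_coe]

lemma IsProjectiveRep.norm_inner_apply_apply (hπ : IsProjectiveRep π) (x y : G) (a b : H) :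
    ‖inner ℂ (π x a) (π y b)‖ = ‖coeff π a b (y⁻¹ * x)‖ := by
  rw [coeff, ← hπ.norm_inner_mul y (y⁻¹ * x), mul_inv_cancel_left]

lemma IsProjectiveRep.norm_coeff_inv (hπ : IsProjectiveRep π) (x : G) (a b : H) :
    ‖coeff π a b x⁻¹‖ = ‖coeff π b a x‖ := by
  obtain ⟨c, hc⟩ := hπ.exists_one
  have h := hπ.norm_inner_apply_apply 1 x a b
  rw [mul_one] at h
  rw [← h, hc, inner_smul_left, norm_mul, coeff, norm_inner_symm]
  simp [Circle.norm_coe]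

lemma IsProjectiveRep.norm_coeff_one (hπ : IsProjectiveRep π) (g : H) :
    ‖coeff π g g 1‖ = ‖g‖ ^ 2 := by
  obtain ⟨c, hc⟩ := hπ.exists_one
  rw [coeff, hc, inner_smul_left, norm_mul, inner_self_eq_norm_sq_to_K]
  simp [Circle.norm_coe]

/-- The cocycle phase does not depend on the vector, so it cancels against its conjugate. -/
lemma IsProjectiveRep.coeff_mul_translate (hπ : IsProjectiveRep π) (g a b : H) (y z : G) :
    coeff π g (π y a) (y * z) * (starRingEnd ℂ) (coeff π g (π y b) (y * z)) =
      coeff π g a z * (starRingEnd ℂ) (coeff π g b z) := by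
  obtain ⟨σ, hσ⟩ := hπ.exists_cocycle
  simp only [coeff, hσ, inner_smul_left, LinearIsometryEquiv.inner_map_map, map_mul,
    RingHomCompTriple.comp_apply, RingHom.id_apply]
  have : (starRingEnd ℂ) (σ y z : ℂ) * (σ y z : ℂ) = 1 := by
    rw [Complex.conj_mul']; simp [Circle.norm_coe]
  linear_combination (inner ℂ (π z g) a * inner ℂ b (π z g)) * this +
    (starRingEnd ℂ (σ y z : ℂ) * inner ℂ (π z g) a * (σ y z : ℂ)) * inner_conj_symm (𝕜 := ℂ) b (π z g)
      - (inner ℂ (π z g) a) * inner_conj_symm (𝕜 := ℂ) b (π z g)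

lemma IsProjectiveRep.norm_coeff_translate (hπ : IsProjectiveRep π) (g a : H) (y z : G) :
    ‖coeff π g (π y a) (y * z)‖ = ‖coeff π g a z‖ := by
  rw [coeff, hπ.norm_inner_mul, coeff]

lemma IsProjectiveRep.stronglyMeasurable_coeff (hπ : IsProjectiveRep π) (g f : H) :
    StronglyMeasurable (coeff π g f) :=
  (hπ.stronglyMeasurable g).inner stronglyMeasurable_const

end RepresentationBasics

/-! ### Inversion invariance, and continuity of coefficient moduli. -/

section Haar

variable {G : Type*} [Group G] [TopologicalSpace G] [IsTopologicalGroup G]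
    [LocallyCompactSpace G] [SecondCountableTopology G] [MeasurableSpace G] [BorelSpace G]

/-- A bi-invariant Haar measure is invariant under inversion. -/
lemma isInvInvariant_of_unimodular (μ : Measure G) [μ.IsHaarMeasure] [μ.IsMulRightInvariant] :
    μ.IsInvInvariant := by
  obtain ⟨K, hK, hK1⟩ := exists_compact_mem_nhds (1 : G)
  set c : NNReal := Measure.haarScalarFactor μ.inv μ
  -- Right invariance of `μ` makes `μ.inv` left invariant, hence a multiple of `μ`; the symmetric
  -- set `K * K⁻¹` forces the factor to be `1`.
  have h : μ.inv = c • μ := Measure.isMulLeftInvariant_eq_smul _ _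
  have hL : IsCompact (K * K⁻¹) := hK.mul hK.inv
  have hinv : (K * K⁻¹)⁻¹ = K * K⁻¹ := by simp
  have hpos : μ (K * K⁻¹) ≠ 0 := by
    have : (K * K⁻¹) ∈ 𝓝 (1 : G) := by
      refine mem_of_superset hK1 fun x hx => ?_
      exact ⟨x, hx, 1, by simpa using mem_of_mem_nhds hK1, by simp⟩
    exact (Measure.measure_pos_of_mem_nhds μ this).ne'
  have h1 : μ (K * K⁻¹) = c * μ (K * K⁻¹) := by
    have := congrArg (fun ν : Measure G => ν (K * K⁻¹)) h
    simpa [Measure.inv_apply, hinv] using this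
  have hc : (c : ℝ≥0∞) = 1 := by
    rw [← ENNReal.mul_left_inj hpos hL.measure_ne_top, one_mul]
    exact h1.symm
  have hc' : c = 1 := by exact_mod_cast hc
  exact ⟨by rw [h, hc', one_smul]⟩

variable {H : Type*} [NormedAddCommGroup H] [InnerProductSpace ℂ H] {π : G → H ≃ₗᵢ[ℂ] H}

/-- Near the identity, `π u` moves a given vector by a phase, up to a small error. -/
lemma IsProjectiveRep.eventually_near_phase (hπ : IsProjectiveRep π) (μ : Measure G)
    [μ.IsHaarMeasure] [μ.IsInvInvariant] (g : H) {ε : ℝ} (hε : 0 < ε) :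
    ∀ᶠ u in 𝓝 (1 : G), ∃ c : ℂ, ‖c‖ = 1 ∧ ‖π u g - c • g‖ < ε := by
  have hsm := hπ.stronglyMeasurable g
  obtain ⟨t, htc, ht⟩ := hsm.isSeparable_range
  let E : H → Set G := fun v => (fun x => π x g) ⁻¹' Metric.ball v (ε / 2)
  have hEm : ∀ v, MeasurableSet (E v) := fun v => by
    have : E v = {x | dist (π x g) v < ε / 2} := rfl
    rw [this]
    exact (hsm.dist stronglyMeasurable_const).measurable measurableSet_Iio
  have hcov : (⋃ v ∈ t, E v) = Set.univ := by
    refine Set.eq_univ_of_forall fun x => ?_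
    obtain ⟨v, hv, hd⟩ := Metric.mem_closure_iff.1 (ht ⟨x, rfl⟩) (ε / 2) (by positivity)
    exact Set.mem_biUnion hv hd
  -- Separability of the orbit gives a countable cover, so some `E v` has positive measure. By
  -- Steinhaus, the `u = x / y` with `x⁻¹, y⁻¹ ∈ E v` fill a neighbourhood of `1`, and `π x⁻¹ (π u
  -- g)` is a phase times `π y⁻¹ g`.
  obtain ⟨v, -, hv⟩ : ∃ v ∈ t, μ (E v) ≠ 0 := by
    by_contra! hcon
    have := (measure_biUnion_null_iff htc).2 hcon
    rw [hcov] at this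
    exact NeZero.ne μ (Measure.measure_univ_eq_zero.1 this)
  have hpos : 0 < μ (E v)⁻¹ := by
    rw [Measure.measure_inv]; exact pos_iff_ne_zero.2 hv
  have hnhds := Measure.div_mem_nhds_one_of_haar_pos μ _ (hEm v).inv hpos
  obtain ⟨σ, hσ⟩ := hπ.exists_cocycle
  filter_upwards [hnhds] with u hu
  obtain ⟨x, hx, y, hy, rfl⟩ := hu
  have hx' : ‖π x⁻¹ g - v‖ < ε / 2 := by simpa [E, dist_eq_norm] using hx
  have hy' : ‖π y⁻¹ g - v‖ < ε / 2 := by simpa [E, dist_eq_norm] using hy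
  have h := hσ x⁻¹ (x / y) g
  have h2 : x⁻¹ * (x / y) = y⁻¹ := by rw [div_eq_mul_inv, inv_mul_cancel_left]
  rw [h2] at h
  set s : Circle := σ x⁻¹ (x / y)
  refine ⟨((s⁻¹ : Circle) : ℂ), Circle.norm_coe _, ?_⟩
  have h3 : π x⁻¹ (π (x / y) g) = ((s⁻¹ : Circle) : ℂ) • π y⁻¹ g := by
    rw [h, smul_smul, ← Circle.coe_mul]; simp
  rw [← (π x⁻¹).norm_map, map_sub, h3, map_smul, ← smul_sub, norm_smul, Circle.norm_coe, one_mul]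
  calc ‖π y⁻¹ g - π x⁻¹ g‖ = ‖(π y⁻¹ g - v) - (π x⁻¹ g - v)‖ := by congr 1; abel
    _ ≤ ‖π y⁻¹ g - v‖ + ‖π x⁻¹ g - v‖ := norm_sub_le _ _
    _ < ε := by linarith

/-- Although `π` is only assumed measurable, the moduli of its coefficients are continuous. -/
lemma IsProjectiveRep.continuous_norm_coeff (hπ : IsProjectiveRep π) (μ : Measure G)
    [μ.IsHaarMeasure] [μ.IsInvInvariant] (g f : H) : Continuous fun x => ‖coeff π g f x‖ := by
  refine continuous_iff_continuousAt.2 fun p => ?_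
  -- Writing `f = π p f'` moves continuity at `p` to continuity at `1`.
  obtain ⟨f', rfl⟩ := (π p).surjective f
  have key : Tendsto (fun u => ‖coeff π g f' u‖) (𝓝 1) (𝓝 ‖coeff π g f' 1‖) := by
    obtain ⟨c₁, hc₁⟩ := hπ.exists_one
    have h1 : ‖coeff π g f' 1‖ = ‖(inner ℂ g f' : ℂ)‖ := by
      rw [coeff, hc₁, inner_smul_left, norm_mul]; simp [Circle.norm_coe]
    rw [Metric.tendsto_nhds]
    intro ε hε
    filter_upwards [hπ.eventually_near_phase μ g
      (show 0 < ε / (‖f'‖ + 1) by positivity)] with u ⟨c, hc, hu⟩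
    have h2 : ‖(inner ℂ g f' : ℂ)‖ = ‖(inner ℂ (c • g) f' : ℂ)‖ := by
      rw [inner_smul_left, norm_mul]; simp [hc]
    rw [h1, h2, Real.dist_eq]
    calc _ ≤ ‖coeff π g f' u - inner ℂ (c • g) f'‖ := abs_norm_sub_norm_le _ _
      _ = ‖(inner ℂ (π u g - c • g) f' : ℂ)‖ := by rw [inner_sub_left, coeff]
      _ ≤ ‖π u g - c • g‖ * ‖f'‖ := norm_inner_le_norm _ _
      _ ≤ ε / (‖f'‖ + 1) * ‖f'‖ := by gcongr
      _ < ε := by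
        rw [div_mul_eq_mul_div, div_lt_iff₀ (by positivity)]
        nlinarith [norm_nonneg f']
  have hp : Tendsto (fun x => p⁻¹ * x) (𝓝 p) (𝓝 1) := by
    have : Continuous fun x : G => p⁻¹ * x := by fun_prop
    simpa using this.tendsto p
  have h := key.comp hp
  have e : ∀ x, ‖coeff π g (π p f') x‖ = ‖coeff π g f' (p⁻¹ * x)‖ := fun x => by
    rw [← hπ.norm_coeff_translate g f' p, mul_inv_cancel_left]
  rw [ContinuousAt]
  simp only [e]
  rw [inv_mul_cancel]
  exact h

end Haar

end CoherentFrames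

namespace CoherentFrames

/-! ### Schur's lemma through the functional calculus. -/

section Schur

variable {G : Type*} {H : Type*} [NormedAddCommGroup H] [InnerProductSpace ℂ H]
  {π : G → H ≃ₗᵢ[ℂ] H}

/-- Schur's lemma for self-adjoint operators. -/
lemma IsIrreducible.exists_eq_smul [CompleteSpace H] (hπ : IsIrreducible π) (T : H →L[ℂ] H)
    (hT : IsSelfAdjoint T) (hc : ∀ x f, T (π x f) = π x (T f)) :
    ∃ t : ℝ, ∀ f, T f = (t : ℂ) • f := by
  suffices h : ∃ t : ℝ, spectrum ℝ T ⊆ {t} by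
    obtain ⟨t, ht⟩ := h
    refine ⟨t, fun f => ?_⟩
    have := CFC.eq_algebraMap_of_spectrum_subset_singleton T t ht hT
    rw [this, Algebra.algebraMap_eq_smul_one]
    simp
  by_cases hne : (spectrum ℝ T).Nonempty
  swap
  · exact ⟨0, by simp [Set.not_nonempty_iff_eq_empty.1 hne]⟩
  obtain ⟨a, ha⟩ := hne
  refine ⟨a, fun b hb => ?_⟩
  by_contra hab
  have hab : b ≠ a := hab
  have hδ : 0 < |a - b| / 2 := by
    have : 0 < |a - b| := abs_pos.2 (sub_ne_zero.2 hab.symm)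
    positivity
  set δ := |a - b| / 2 with hδd
  -- Bumps at two spectral points `a ≠ b` vanish outside disjoint intervals: both operators are
  -- non-zero but their product is zero. The kernel of the first is then a non-trivial closed
  -- invariant subspace.
  let bump : ℝ → ℝ → ℝ := fun r x => max 0 (δ - |x - r|)
  have hcont : ∀ r, Continuous (bump r) := fun r => by fun_prop
  have hnt : Nontrivial (H →L[ℂ] H) := by
    by_contra h
    rw [not_nontrivial_iff_subsingleton] at h
    simp [spectrum.of_subsingleton] at ha
  have hnz : ∀ r ∈ spectrum ℝ T, cfc (bump r) T ≠ 0 := by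
    intro r hr h0
    have h1 : bump r r ∈ spectrum ℝ (cfc (bump r) T) := by
      rw [cfc_map_spectrum (bump r) T hT (hcont r).continuousOn]
      exact ⟨r, hr, rfl⟩
    rw [h0, spectrum.zero_eq] at h1
    have : bump r r = δ := by simp [bump, hδ.le]
    rw [this] at h1
    exact hδ.ne' h1
  have hmul : cfc (bump a) T * cfc (bump b) T = 0 := by
    rw [← cfc_mul (bump a) (bump b) T (hcont a).continuousOn (hcont b).continuousOn]
    have : (fun x => bump a x * bump b x) = fun _ => 0 := by
      ext x
      by_cases h : δ ≤ |x - a|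
      · simp [bump, h]
      · have h1 : δ ≤ |x - b| := by
          have := abs_sub_le a x b
          rw [abs_sub_comm a x] at this
          linarith [not_le.1 h]
        simp [bump, h1]
    rw [this, cfc_const_zero]
  let P : G → H →L[ℂ] H := fun x => (π x).toContinuousLinearEquiv
  have hcomm : ∀ x, Commute (cfc (bump a) T) (P x) := fun x => by
    have : Commute T (P x) := by
      ext f; exact hc x f
    exact this.cfc_real (bump a)
  have hW := hπ (LinearMap.ker (cfc (bump a) T : H →L[ℂ] H).toLinearMap)
    (ContinuousLinearMap.isClosed_ker _) (fun x f hf => by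
      have h1 := congrArg (fun S : H →L[ℂ] H => S f) (hcomm x).eq
      have h2 : cfc (bump a) T f = 0 := hf
      have h3 : cfc (bump a) T (P x f) = P x (cfc (bump a) T f) := h1
      rw [h2, map_zero] at h3
      exact h3)
  rcases hW with hW | hW
  · apply hnz b hb
    ext f
    have : cfc (bump b) T f ∈ LinearMap.ker (cfc (bump a) T : H →L[ℂ] H).toLinearMap :=
      congrArg (fun S : H →L[ℂ] H => S f) hmul
    rw [hW] at this
    simpa using this
  · apply hnz a ha
    ext f
    have : f ∈ LinearMap.ker (cfc (bump a) T : H →L[ℂ] H).toLinearMap := by rw [hW]; trivial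
    exact this

end Schur

end CoherentFrames

namespace CoherentFrames

/-! ### Orthogonality relations and existence of the formal degree. -/

section FormalDegree

variable {G : Type*} [Group G] [TopologicalSpace G] [IsTopologicalGroup G]
    [LocallyCompactSpace G] [SecondCountableTopology G] [MeasurableSpace G] [BorelSpace G]
variable {H : Type*} [NormedAddCommGroup H] [InnerProductSpace ℂ H] {π : G → H ≃ₗᵢ[ℂ] H}
variable {μ : Measure G}

lemma IsProjectiveRep.memLp_coeff_iff (hπ : IsProjectiveRep π) (g f : H) :
    MemLp (coeff π g f) 2 μ ↔ Integrable (fun x => ‖coeff π g f x‖ ^ 2) μ :=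
  memLp_two_iff_integrable_sq_norm (hπ.stronglyMeasurable_coeff g f).aestronglyMeasurable

lemma IsProjectiveRep.memLp_coeff_translate [μ.IsMulLeftInvariant] (hπ : IsProjectiveRep π)
    {g f : H} (y : G) (h : MemLp (coeff π g f) 2 μ) : MemLp (coeff π g (π y f)) 2 μ := by
  rw [hπ.memLp_coeff_iff] at h ⊢
  refine (h.comp_mul_left y⁻¹).congr (Eventually.of_forall fun x => ?_)
  have := hπ.norm_coeff_translate g f y (y⁻¹ * x)
  rw [mul_inv_cancel_left] at this
  simp only [this]

lemma IsProjectiveRep.memLp_coeff_translate_symm [μ.IsMulLeftInvariant] (hπ : IsProjectiveRep π)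
    {g f : H} (y : G) (h : MemLp (coeff π g f) 2 μ) : MemLp (coeff π g ((π y).symm f)) 2 μ := by
  rw [hπ.memLp_coeff_iff] at h ⊢
  refine (h.comp_mul_left y).congr (Eventually.of_forall fun x => ?_)
  have := hπ.norm_coeff_translate g ((π y).symm f) y x
  rw [LinearIsometryEquiv.apply_symm_apply] at this
  simp only [this]

lemma IsProjectiveRep.memLp_coeff_swap [μ.IsInvInvariant] (hπ : IsProjectiveRep π)
    {g f : H} (h : MemLp (coeff π g f) 2 μ) : MemLp (coeff π f g) 2 μ := by
  rw [hπ.memLp_coeff_iff] at h ⊢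
  refine h.comp_inv.congr (Eventually.of_forall fun x => ?_)
  simp only [hπ.norm_coeff_inv]

lemma coeff_add (g a b : H) : coeff π g (a + b) = coeff π g a + coeff π g b := by
  ext x; exact inner_add_right _ _ _

lemma coeff_smul (g : H) (c : ℂ) (a : H) : coeff π g (c • a) = c • coeff π g a := by
  ext x; exact inner_smul_right _ _ _

variable (π μ) in
/-- The graph of the coefficient map `f ↦ V_g f`, restricted to the vectors with square-integrable
coefficient. -/
noncomputable def coeffGraph (g : H) : Submodule ℂ (WithLp 2 (H × Lp ℂ 2 μ)) where
  carrier := {e | e.snd =ᵐ[μ] coeff π g e.fst}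
  zero_mem' := by
    have : coeff π g 0 = 0 := by ext x; exact inner_zero_right _
    change ((0 : Lp ℂ 2 μ) : G → ℂ) =ᵐ[μ] coeff π g 0
    rw [this]
    exact Lp.coeFn_zero _ _ _
  add_mem' := by
    intro a b ha hb
    change ((a.snd + b.snd : Lp ℂ 2 μ) : G → ℂ) =ᵐ[μ] coeff π g (a.fst + b.fst)
    rw [coeff_add]
    exact (Lp.coeFn_add _ _).trans (EventuallyEq.add (show _ =ᵐ[μ] _ from ha) hb)
  smul_mem' := by
    intro c a ha
    change ((c • a.snd : Lp ℂ 2 μ) : G → ℂ) =ᵐ[μ] coeff π g (c • a.fst)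
    rw [coeff_smul]
    exact (Lp.coeFn_smul _ _).trans (EventuallyEq.const_smul (show _ =ᵐ[μ] _ from ha) c)

/-- Convergence in `L²` gives almost everywhere convergence along a subsequence, while convergence
in `H` gives pointwise convergence of coefficients. This replaces boundedness of `V_g`, and makes
the graph a Hilbert space. -/
lemma isClosed_coeffGraph (g : H) :
    IsClosed (coeffGraph π μ g : Set (WithLp 2 (H × Lp ℂ 2 μ))) := by
  refine IsSeqClosed.isClosed fun e e₀ he hlim => ?_
  have hc : Tendsto (fun n => WithLp.ofLp (e n)) atTop (𝓝 (WithLp.ofLp e₀)) :=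
    ((WithLp.prod_continuous_ofLp 2 H (Lp ℂ 2 μ)).tendsto e₀).comp hlim
  have h1 : Tendsto (fun n => (e n).fst) atTop (𝓝 e₀.fst) := (continuous_fst.tendsto _).comp hc
  have h2 : Tendsto (fun n => (e n).snd) atTop (𝓝 e₀.snd) := (continuous_snd.tendsto _).comp hc
  obtain ⟨ns, hns, hae⟩ := (tendstoInMeasure_of_tendsto_Lp h2).exists_seq_tendsto_ae
  have hall : ∀ᵐ x ∂μ, ∀ n, (e n).snd x = coeff π g (e n).fst x := ae_all_iff.2 he
  change (e₀.snd : G → ℂ) =ᵐ[μ] coeff π g e₀.fst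
  filter_upwards [hae, hall] with x hx hx2
  simp only [hx2] at hx
  refine tendsto_nhds_unique hx ?_
  exact tendsto_const_nhds.inner (h1.comp hns.tendsto_atTop)

lemma memLp_of_mem_coeffGraph {g : H} (e : coeffGraph π μ g) :
    MemLp (coeff π g (e : WithLp 2 (H × Lp ℂ 2 μ)).fst) 2 μ :=
  (memLp_congr_ae e.2).1 (Lp.memLp _)

/-- The point of the graph over a vector with square-integrable coefficient. -/
noncomputable def coeffGraphMk {g f : H} (h : MemLp (coeff π g f) 2 μ) : coeffGraph π μ g :=
  ⟨WithLp.toLp 2 (f, h.toLp _), h.coeFn_toLp⟩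

lemma inner_coeffGraph {g : H} (e e' : coeffGraph π μ g) :
    inner ℂ e e' = inner ℂ (e : WithLp 2 (H × Lp ℂ 2 μ)).fst (e' : WithLp 2 (H × Lp ℂ 2 μ)).fst +
      ∫ x, coeff π g (e' : WithLp 2 (H × Lp ℂ 2 μ)).fst x *
        (starRingEnd ℂ) (coeff π g (e : WithLp 2 (H × Lp ℂ 2 μ)).fst x) ∂μ := by
  rw [Submodule.coe_inner, WithLp.prod_inner_apply]
  congr 1
  refine (L2.inner_def _ _).trans (integral_congr_ae ?_)
  filter_upwards [e.2, e'.2] with x h1 h2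
  rw [← h1, ← h2]
  rfl

lemma IsProjectiveRep.integral_coeff_translate [μ.IsMulLeftInvariant] (hπ : IsProjectiveRep π)
    (g a b : H) (y : G) :
    ∫ x, coeff π g (π y a) x * (starRingEnd ℂ) (coeff π g (π y b) x) ∂μ =
      ∫ x, coeff π g a x * (starRingEnd ℂ) (coeff π g b x) ∂μ := by
  rw [← integral_mul_left_eq_self _ y]
  exact integral_congr_ae (Eventually.of_forall fun x => hπ.coeff_mul_translate g a b y x)

/-- A non-zero square-integrable coefficient `V_g f₀` makes `V_g` a multiple of an isometry. -/
lemma IsIrreducible.exists_integral_coeff [CompleteSpace H] [μ.IsMulLeftInvariant]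
    (hπ : IsProjectiveRep π) (hirr : IsIrreducible π) {g f₀ : H} (hf₀ : f₀ ≠ 0)
    (h : MemLp (coeff π g f₀) 2 μ) :
    ∃ c : ℝ, (∀ f, MemLp (coeff π g f) 2 μ) ∧ ∀ a b,
      ∫ x, coeff π g b x * (starRingEnd ℂ) (coeff π g a x) ∂μ = c * inner ℂ a b := by
  have : CompleteSpace (coeffGraph π μ g) := (isClosed_coeffGraph g).completeSpace_coe
  -- `J` is the projection of the graph to `H`. Since `π` acts isometrically on the graph by
  -- translation, `J ∘L J'` commutes with `π` and is a scalar `t`.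
  let J : coeffGraph π μ g →L[ℂ] H :=
    (WithLp.fstL 2 ℂ H (Lp ℂ 2 μ)) ∘L (coeffGraph π μ g).subtypeL
  have hJ : ∀ e : coeffGraph π μ g, J e = (e : WithLp 2 (H × Lp ℂ 2 μ)).fst := fun e => rfl
  let J' := ContinuousLinearMap.adjoint J
  have hJ' : ∀ v e, inner ℂ (J' v) e = inner ℂ v (J e) := fun v e =>
    ContinuousLinearMap.adjoint_inner_left J e v
  have hsa : IsSelfAdjoint (J ∘L J') := by
    rw [ContinuousLinearMap.isSelfAdjoint_iff', ContinuousLinearMap.adjoint_comp,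
      ContinuousLinearMap.adjoint_adjoint]
  obtain ⟨t, ht⟩ := hirr.exists_eq_smul (J ∘L J') hsa (by
    intro y v
    have h1 : MemLp (coeff π g (π y (J (J' v)))) 2 μ :=
      hπ.memLp_coeff_translate y (memLp_of_mem_coeffGraph (J' v))
    have h2 : J' (π y v) = coeffGraphMk h1 := by
      refine ext_inner_right ℂ fun e => ?_
      obtain ⟨b, hb⟩ := (π y).surjective (J e)
      have hbm : MemLp (coeff π g b) 2 μ := by
        have := hπ.memLp_coeff_translate_symm y (memLp_of_mem_coeffGraph e)
        rwa [← hJ, ← hb, LinearIsometryEquiv.symm_apply_apply] at this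
      rw [hJ', inner_coeffGraph, ← hJ e, ← hb, LinearIsometryEquiv.inner_map_map]
      change _ = inner ℂ (π y (J (J' v))) (π y b) +
        ∫ x, coeff π g (π y b) x * (starRingEnd ℂ) (coeff π g (π y (J (J' v))) x) ∂μ
      rw [hπ.integral_coeff_translate, LinearIsometryEquiv.inner_map_map]
      have h3 := inner_coeffGraph (J' v) (coeffGraphMk hbm)
      rw [hJ'] at h3
      exact h3
    change J (J' (π y v)) = π y (J (J' v))
    rw [h2]
    rfl)
  have ht' : ∀ v, J (J' v) = (t : ℂ) • v := ht
  -- If `t = 0` then `J' = 0`, although `f₀ ≠ 0` lies in the range of `J`.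
  have ht0 : (t : ℂ) ≠ 0 := by
    intro h0
    have h1 : ∀ v, J' v = 0 := fun v => by
      rw [← inner_self_eq_zero (𝕜 := ℂ), hJ', ht', h0, zero_smul, inner_zero_right]
    have h2 := hJ' f₀ (coeffGraphMk h)
    rw [h1, inner_zero_left] at h2
    exact hf₀ (inner_self_eq_zero.1 h2.symm)
  have hall : ∀ f, MemLp (coeff π g f) 2 μ := fun f => by
    have h1 := memLp_of_mem_coeffGraph (J' f)
    rw [← hJ, ht', coeff_smul] at h1
    have h2 := h1.const_smul (t : ℂ)⁻¹
    rwa [smul_smul, inv_mul_cancel₀ ht0, one_smul] at h2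
  -- Pairing `J' a` with the graph point over `b` gives `⟨a, b⟩ = t ⟨a, b⟩ + t ∫`, which is solved
  -- for the integral.
  refine ⟨(1 - t) / t, hall, fun a b => ?_⟩
  have h1 := inner_coeffGraph (J' a) (coeffGraphMk (hall b))
  rw [hJ', ← hJ, ← hJ, ht'] at h1
  change inner ℂ a b = inner ℂ ((t : ℂ) • a) b +
    ∫ x, coeff π g b x * (starRingEnd ℂ) (coeff π g ((t : ℂ) • a) x) ∂μ at h1
  have h2 : ∫ x, coeff π g b x * (starRingEnd ℂ) (coeff π g ((t : ℂ) • a) x) ∂μ =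
      t * ∫ x, coeff π g b x * (starRingEnd ℂ) (coeff π g a x) ∂μ := by
    rw [← integral_const_mul]
    refine integral_congr_ae (Eventually.of_forall fun x => ?_)
    simp only [coeff_smul, Pi.smul_apply, smul_eq_mul, map_mul, Complex.conj_ofReal]
    ring
  rw [h2, inner_smul_left, Complex.conj_ofReal] at h1
  push_cast
  field_simp
  linear_combination -h1

/-- The orthogonality relations, in quadratic form. -/
lemma IsDiscreteSeries.exists_const [CompleteSpace H] [μ.IsHaarMeasure] [μ.IsInvInvariant]
    (hπ : IsDiscreteSeries μ π) :
    ∃ c : ℝ, 0 < c ∧ (∀ g f, MemLp (coeff π g f) 2 μ) ∧ ∀ g a b,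
      ∫ x, coeff π g b x * (starRingEnd ℂ) (coeff π g a x) ∂μ = c * ‖g‖ ^ 2 * inner ℂ a b := by
  have hp := hπ.toIsProjectiveRep
  obtain ⟨g₀, hg₀, hint⟩ := hπ.squareIntegrable
  have hm : MemLp (coeff π g₀ g₀) 2 μ := by
    refine ⟨(hp.stronglyMeasurable_coeff _ _).aestronglyMeasurable, ?_⟩
    rw [eLpNorm_lt_top_iff_lintegral_rpow_enorm_lt_top (by norm_num) (by norm_num)]
    simpa using hint
  obtain ⟨-, hall₀, -⟩ := hπ.irreducible.exists_integral_coeff hp hg₀ hm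
  -- One integrable coefficient makes all `V_{g₀} f` square-integrable; inversion turns them into
  -- `V_f g₀`, so every window qualifies.
  have hex := fun g => hπ.irreducible.exists_integral_coeff hp hg₀ (hp.memLp_coeff_swap (hall₀ g))
  choose c hall hc using hex
  have hsq : ∀ g f, ∫ x, ‖coeff π g f x‖ ^ 2 ∂μ = c g * ‖f‖ ^ 2 := by
    intro g f
    have h1 := hc g f f
    simp only [Complex.mul_conj', inner_self_eq_norm_sq_to_K] at h1
    have h2 : ((∫ x, ‖coeff π g f x‖ ^ 2 ∂μ : ℝ) : ℂ) = ((c g * ‖f‖ ^ 2 : ℝ) : ℂ) := by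
      rw [← integral_complex_ofReal]
      push_cast
      exact h1
    exact_mod_cast h2
  -- Inversion exchanges window and vector; hence `c g` is proportional to `‖g‖ ^ 2`.
  have hswap : ∀ g f, c g * ‖f‖ ^ 2 = c f * ‖g‖ ^ 2 := by
    intro g f
    rw [← hsq, ← hsq, ← integral_inv_eq_self _ μ]
    simp only [hp.norm_coeff_inv]
  have hn : 0 < ‖g₀‖ ^ 2 := by positivity
  refine ⟨c g₀ / ‖g₀‖ ^ 2, div_pos ?_ hn, hall, fun g a b => ?_⟩
  · have h1 : 0 ≤ c g₀ * ‖g₀‖ ^ 2 := by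
      rw [← hsq]; exact integral_nonneg fun _ => by positivity
    have h2 : 0 ≤ c g₀ := nonneg_of_mul_nonneg_left h1 hn
    -- A zero constant would make the continuous `‖coeff π g₀ g₀ x‖ ^ 2` vanish identically, but at
    -- `1` it is `‖g₀‖ ^ 4`.
    refine lt_of_le_of_ne h2 fun h0 => ?_
    have h3 := hsq g₀ g₀
    rw [← h0, zero_mul, integral_eq_zero_iff_of_nonneg (fun _ => by positivity)
      ((hp.memLp_coeff_iff _ _).1 hm)] at h3
    have h4 := (Continuous.ae_eq_iff_eq μ ((hp.continuous_norm_coeff μ g₀ g₀).pow 2)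
      continuous_zero).1 h3
    have h5 := congrFun h4 1
    simp [hp.norm_coeff_one, hg₀] at h5
  · rw [hc g a b]
    congr 1
    have h1 := hswap g g₀
    have h2 : c g = c g₀ / ‖g₀‖ ^ 2 * ‖g‖ ^ 2 := by field_simp; exact h1
    rw [h2]
    push_cast
    rfl

/-- A discrete series representation of a unimodular group has a formal degree. -/
lemma IsDiscreteSeries.exists_formalDegree [CompleteSpace H] [μ.IsHaarMeasure] [μ.IsInvInvariant]
    (hπ : IsDiscreteSeries μ π) :
    ∃ d : ℝ, IsFormalDegree μ π d := by
  obtain ⟨c, hc, hm, hQ⟩ := hπ.exists_const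
  refine ⟨c⁻¹, inv_pos.2 hc, fun f₁ f₂ g₁ g₂ => ?_⟩
  have hinner : ∀ g x, inner ℂ f₂ (π x g) = (starRingEnd ℂ) (coeff π g f₂ x) := fun g x =>
    (inner_conj_symm _ _).symm
  have hI : ∀ a b, Integrable (fun x => coeff π a f₁ x * inner ℂ f₂ (π x b)) μ := fun a b => by
    simp only [hinner]
    exact (hm a f₁).integrable_mul (hm b f₂).star
  refine ⟨hI g₁ g₂, ?_⟩
  have hd : ∀ g, ∫ x, coeff π g f₁ x * inner ℂ f₂ (π x g) ∂μ = c * inner ℂ g g * inner ℂ f₂ f₁ := by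
    intro g
    simp only [hinner, inner_self_eq_norm_sq_to_K]
    exact hQ g f₂ f₁
  -- Polarization in the window, with `f₁` and `f₂` fixed.
  have hpol : ∀ x, coeff π g₁ f₁ x * inner ℂ f₂ (π x g₂) = (1 / 4 : ℂ) *
      (coeff π (g₁ + g₂) f₁ x * inner ℂ f₂ (π x (g₁ + g₂))
      - coeff π (g₁ - g₂) f₁ x * inner ℂ f₂ (π x (g₁ - g₂))
      + Complex.I * (coeff π (Complex.I • g₁ + g₂) f₁ x * inner ℂ f₂ (π x (Complex.I • g₁ + g₂)))
      - Complex.I * (coeff π (Complex.I • g₁ - g₂) f₁ x *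
        inner ℂ f₂ (π x (Complex.I • g₁ - g₂)))) := by
    intro x
    simp only [coeff, map_add, map_sub, map_smul, inner_add_left, inner_sub_left, inner_add_right,
      inner_sub_right, inner_smul_left, inner_smul_right, Complex.conj_I]
    linear_combination (1 / 2 * (inner ℂ (π x g₁) f₁ * inner ℂ f₂ (π x g₂) -
      inner ℂ (π x g₂) f₁ * inner ℂ f₂ (π x g₁))) * Complex.I_sq
  simp only [hpol]
  rw [integral_const_mul, integral_sub, integral_add, integral_sub, integral_const_mul,
    integral_const_mul, hd, hd, hd, hd]
  · rw [inner_conj_symm]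
    push_cast
    simp only [inner_add_left, inner_sub_left, inner_add_right,
      inner_sub_right, inner_smul_left, inner_smul_right, Complex.conj_I, inv_inv]
    linear_combination (-1 / 2 * c * inner ℂ f₂ f₁ * (inner ℂ g₁ g₂ - inner ℂ g₂ g₁)) *
      Complex.I_sq
  all_goals first
    | exact hI _ _
    | exact (hI _ _).const_mul _
    | exact (hI _ _).sub (hI _ _)
    | exact ((hI _ _).sub (hI _ _)).add ((hI _ _).const_mul _)

end FormalDegree

end CoherentFrames

namespace CoherentFrames

/-! ### Frames, dual frames and exact frames. -/

section Frames

variable {H : Type*} [NormedAddCommGroup H] [InnerProductSpace ℂ H] {ι : Type*} {φ : ι → H}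

lemma memℓp_two_of_summable {f : ι → ℂ} (h : Summable fun i => ‖f i‖ ^ 2) : Memℓp f 2 :=
  memℓp_gen (by simpa using h)

lemma lp_norm_sq (f : lp (fun _ : ι => ℂ) 2) : ‖f‖ ^ 2 = ∑' i, ‖f i‖ ^ 2 := by
  have := lp.norm_rpow_eq_tsum (p := 2) (by norm_num) f
  simpa using this

/-- The analysis operator of a frame. -/
lemma IsFrame.exists_analysis (h : IsFrame φ) :
    ∃ (A : ℝ) (C : H →L[ℂ] lp (fun _ : ι => ℂ) 2), 0 < A ∧
      (∀ f i, C f i = inner ℂ (φ i) f) ∧ ∀ f, A * ‖f‖ ^ 2 ≤ ‖C f‖ ^ 2 := by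
  obtain ⟨A, B, hA, hB, h⟩ := h
  let C₀ : H →ₗ[ℂ] lp (fun _ : ι => ℂ) 2 :=
    { toFun := fun f => ⟨fun i => inner ℂ (φ i) f, memℓp_two_of_summable (h f).1⟩
      map_add' := fun f g => by ext i; exact inner_add_right _ _ _
      map_smul' := fun c f => by ext i; simp }
  have hC₀ : ∀ f, ‖C₀ f‖ ^ 2 = ∑' i, ‖inner ℂ (φ i) f‖ ^ 2 := fun f => lp_norm_sq _
  refine ⟨A, C₀.mkContinuous (√B) fun f => ?_, hA, fun f i => rfl, fun f => ?_⟩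
  · refine abs_le_of_sq_le_sq' ?_ (by positivity) |>.2
    rw [hC₀, mul_pow, Real.sq_sqrt hB.le]
    exact (h f).2.2
  · exact (h f).2.1.trans_eq (hC₀ f).symm

variable {A : ℝ} {C : H →L[ℂ] lp (fun _ : ι => ℂ) 2}

lemma antilipschitz_of_lower_bound (hA : 0 < A) (hC : ∀ f, A * ‖f‖ ^ 2 ≤ ‖C f‖ ^ 2) :
    ∃ K, AntilipschitzWith K C := by
  refine ⟨(√A)⁻¹.toNNReal, AddMonoidHomClass.antilipschitz_of_bound C fun f => ?_⟩
  rw [Real.coe_toNNReal _ (by positivity), ← div_eq_inv_mul, le_div_iff₀ (by positivity)]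
  refine abs_le_of_sq_le_sq' ?_ (by positivity) |>.2
  rw [mul_pow, Real.sq_sqrt hA.le, mul_comm]
  exact hC f

lemma isClosed_range_of_lower_bound [CompleteSpace H] (hA : 0 < A)
    (hC : ∀ f, A * ‖f‖ ^ 2 ≤ ‖C f‖ ^ 2) : IsClosed (Set.range C) := by
  obtain ⟨K, hK⟩ := antilipschitz_of_lower_bound hA hC
  exact hK.isClosed_range C.uniformContinuous

/-- The synthesis operator of a dual frame: a left inverse of the analysis operator. -/
lemma exists_left_inverse [CompleteSpace H] (hA : 0 < A)
    (hC : ∀ f, A * ‖f‖ ^ 2 ≤ ‖C f‖ ^ 2) :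
    ∃ L : lp (fun _ : ι => ℂ) 2 →ₗ[ℂ] H, (∀ f, L (C f) = f) ∧ ∀ a, A * ‖L a‖ ^ 2 ≤ ‖a‖ ^ 2 := by
  obtain ⟨K, hK⟩ := antilipschitz_of_lower_bound hA hC
  have hcl := isClosed_range_of_lower_bound hA hC
  let e := LinearEquiv.ofInjective C.toLinearMap hK.injective
  let R := LinearMap.range C.toLinearMap
  have hcl' : IsClosed (R : Set (lp (fun _ : ι => ℂ) 2)) := hcl
  have : CompleteSpace R := hcl'.completeSpace_coe
  have he : ∀ r : R, C (e.symm r) = r := fun r => congrArg Subtype.val (e.apply_symm_apply r)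
  -- Projecting onto the closed range first extends the norm bound for the inverse to all of `ℓ²`.
  refine ⟨e.symm.toLinearMap ∘ₗ R.orthogonalProjectionOnto.toLinearMap, fun f => ?_, fun a => ?_⟩
  · apply hK.injective
    have hf : C f ∈ R := ⟨f, rfl⟩
    have : C (e.symm (R.orthogonalProjectionOnto (C f))) = C f := by
      rw [he]
      exact Submodule.starProjection_eq_self_iff.2 hf
    exact this
  · have h1 := hC (e.symm (R.orthogonalProjectionOnto a))
    rw [he] at h1
    refine h1.trans ?_
    gcongr
    exact R.norm_orthogonalProjectionOnto_apply_le a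

/-- Up to a controlled error, a vector is reconstructed from finitely many frame coefficients by
vectors of a dual frame. -/
lemma IsFrame.exists_dual [CompleteSpace H] (h : IsFrame φ) :
    ∃ (A : ℝ) (ψ : ι → H), 0 < A ∧ ∀ (u : H) (F : Finset ι) (ε : ℝ),
      (∀ F' : Finset ι, Disjoint F F' → ∑ i ∈ F', ‖inner ℂ (φ i) u‖ ^ 2 ≤ ε) →
      A * ‖u - ∑ i ∈ F, inner ℂ (φ i) u • ψ i‖ ^ 2 ≤ ε := by
  classical
  obtain ⟨A, C, hA, hCi, hC⟩ := h.exists_analysis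
  obtain ⟨L, hL, hLA⟩ := exists_left_inverse hA hC
  -- The dual vectors are the images of the unit sequences, so the error is `L` applied to the
  -- coefficients outside `F`.
  refine ⟨A, fun i => L (lp.single 2 i 1), hA, fun u F ε hε => ?_⟩
  have h1 : u - ∑ i ∈ F, inner ℂ (φ i) u • L (lp.single 2 i 1) =
      L (C u - ∑ i ∈ F, lp.single 2 i (C u i)) := by
    rw [map_sub, hL, map_sum]
    congr 1
    refine Finset.sum_congr rfl fun i _ => ?_
    rw [← map_smul, ← lp.single_smul, hCi]
    simp
  rw [h1]
  refine (hLA _).trans ?_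
  rw [lp_norm_sq]
  have hj : ∀ j, (C u - ∑ i ∈ F, lp.single 2 i (C u i) : lp (fun _ : ι => ℂ) 2) j =
      if j ∈ F then 0 else C u j := by
    intro j
    rw [lp.coeFn_sub, Pi.sub_apply, lp.coeFn_sum, Finset.sum_apply]
    simp only [lp.coeFn_single, Pi.single_apply, Finset.sum_ite_eq]
    split_ifs <;> simp
  refine Real.tsum_le_of_sum_le (fun _ => by positivity) fun F' => ?_
  refine le_trans (le_of_eq ?_) (hε (F' \ F) Finset.disjoint_sdiff)
  rw [Finset.sdiff_eq_filter, Finset.sum_filter]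
  refine Finset.sum_congr rfl fun j _ => ?_
  rw [hj, hCi]
  split_ifs <;> simp

lemma IsFrame.bessel (h : IsFrame φ) : ∃ B : ℝ, 0 < B ∧ ∀ (u : H) (F : Finset ι),
    ∑ i ∈ F, ‖inner ℂ (φ i) u‖ ^ 2 ≤ B * ‖u‖ ^ 2 := by
  obtain ⟨A, B, hA, hB, h⟩ := h
  exact ⟨B, hB, fun u F => ((h u).1.sum_le_tsum F fun _ _ => by positivity).trans (h u).2.2⟩

/-- The analysis operator of an exact frame is onto. -/
lemma IsRieszBasis.analysis_surjective [CompleteSpace H] (h : IsRieszBasis φ) (hA : 0 < A)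
    (hCi : ∀ f i, C f i = inner ℂ (φ i) f) (hC : ∀ f, A * ‖f‖ ^ 2 ≤ ‖C f‖ ^ 2) :
    Function.Surjective C := by
  classical
  obtain ⟨⟨A', B, hA', hB, hfr⟩, hex⟩ := h
  have hcl := isClosed_range_of_lower_bound hA hC
  have hnorm : ∀ f j, ‖C f - lp.single 2 j (C f j)‖ ^ 2 =
      ∑' i, (if i = j then 0 else ‖inner ℂ (φ i) f‖ ^ 2) := by
    intro f j
    rw [lp_norm_sq]
    refine tsum_congr fun i => ?_
    rw [lp.coeFn_sub, Pi.sub_apply, lp.coeFn_single]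
    by_cases hij : i = j
    · subst hij; simp
    · simp [hij, hCi]
  have hsub : ∀ f j, ∑' i : {i // i ≠ j}, ‖inner ℂ (φ i) f‖ ^ 2 =
      ‖C f - lp.single 2 j (C f j)‖ ^ 2 := by
    intro f j
    rw [hnorm]
    refine (tsum_subtype {i | i ≠ j} fun i => ‖inner ℂ (φ i) f‖ ^ 2).trans (tsum_congr fun i => ?_)
    by_cases hij : i = j
    · subst hij; simp
    · simp [hij]
  -- The range is closed, so reaching all unit sequences suffices. If the `j`-th lies at distance `c
  -- > 0` from it, the `j`-th coefficient is dominated by the others and the frame survives the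
  -- removal of `j`.
  have hδ : ∀ j, lp.single 2 j (1 : ℂ) ∈ Set.range C := by
    intro j
    by_contra hj
    apply hex j
    set c := Metric.infDist (lp.single 2 j (1 : ℂ)) (Set.range C) with hcdef
    have hc : 0 < c := (hcl.notMem_iff_infDist_pos (Set.range_nonempty _)).1 hj
    have hlow : ∀ f, c * ‖C f j‖ ≤ ‖C f - lp.single 2 j (C f j)‖ := by
      intro f
      by_cases h0 : C f j = 0
      · simp [h0]
      · have h1 : C f - lp.single 2 j (C f j) =
            (C f j) • (C ((C f j)⁻¹ • f) - lp.single 2 j 1) := by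
          rw [smul_sub, map_smul, smul_smul, mul_inv_cancel₀ h0, one_smul, ← lp.single_smul]
          simp
        rw [h1, norm_smul, mul_comm]
        gcongr
        rw [← dist_eq_norm, dist_comm]
        exact Metric.infDist_le_dist_of_mem ⟨_, rfl⟩
    -- The coefficient at `j` costs at most `(c ^ 2)⁻¹` times the energy of the others.
    refine ⟨A' / (1 + (c ^ 2)⁻¹), B, by positivity, hB, fun f => ⟨(hfr f).1.subtype _, ?_, ?_⟩⟩
    · rw [hsub, div_mul_eq_mul_div, div_le_iff₀ (by positivity)]
      refine (hfr f).2.1.trans ?_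
      have h1 := (hfr f).1.tsum_eq_add_tsum_ite j
      rw [h1, ← hnorm]
      have h3 : ‖inner ℂ (φ j) f‖ ^ 2 ≤ (c ^ 2)⁻¹ * ‖C f - lp.single 2 j (C f j)‖ ^ 2 := by
        rw [← div_eq_inv_mul, le_div_iff₀ (by positivity), ← hCi, mul_comm, ← mul_pow]
        gcongr
        exact hlow f
      linarith
    · refine le_trans ?_ (hfr f).2.2
      exact Summable.tsum_subtype_le (fun i => ‖inner ℂ (φ i) f‖ ^ 2) {i | i ≠ j}
        (fun _ => by positivity) (hfr f).1
  intro a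
  have := (lp.hasSum_single (p := 2) (by norm_num) a)
  refine hcl.mem_of_tendsto this (Eventually.of_forall fun F => ?_)
  choose v hv using hδ
  refine ⟨∑ i ∈ F, a i • v i, ?_⟩
  rw [map_sum]
  refine Finset.sum_congr rfl fun i _ => ?_
  rw [map_smul, hv, ← lp.single_smul]
  simp

/-- Finite subsystems of an exact frame are linearly independent, with a uniform lower frame bound
on their span. -/
lemma IsRieszBasis.exists_lower_bound [CompleteSpace H] (h : IsRieszBasis φ) :
    ∃ A : ℝ, 0 < A ∧ LinearIndependent ℂ φ ∧ ∀ (F : Finset ι) (u w : H),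
      w ∈ Submodule.span ℂ (φ '' F) → inner ℂ w u = (‖w‖ : ℂ) ^ 2 →
      A * ‖w‖ ^ 2 ≤ ∑ i ∈ F, ‖inner ℂ (φ i) u‖ ^ 2 := by
  classical
  obtain ⟨A, C, hA, hCi, hC⟩ := h.1.exists_analysis
  have hs := h.analysis_surjective hA hCi hC
  have key : ∀ (F : Finset ι) (c : ι → ℂ),
      A * ∑ i ∈ F, ‖c i‖ ^ 2 ≤ ‖∑ i ∈ F, c i • φ i‖ ^ 2 := by
    intro F c
    -- Interpolation: `v` has frame coefficients `c` on `F` and `0` elsewhere, so it pairs with `∑ c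
    -- i • φ i` to `S`, while `A * ‖v‖ ^ 2 ≤ S`; Cauchy–Schwarz concludes.
    obtain ⟨v, hv⟩ := hs (∑ i ∈ F, lp.single 2 i (c i))
    have hvi : ∀ i ∈ F, inner ℂ (φ i) v = c i := by
      intro i hi
      rw [← hCi, hv, lp.coeFn_sum, Finset.sum_apply]
      simp [Pi.single_apply, hi]
    have hn : ‖C v‖ ^ 2 = ∑ i ∈ F, ‖c i‖ ^ 2 := by
      rw [lp_norm_sq, tsum_eq_sum (s := F)]
      · exact Finset.sum_congr rfl fun i hi => by rw [hCi, hvi i hi]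
      · intro i hi
        rw [hv, lp.coeFn_sum, Finset.sum_apply]
        simp [Pi.single_apply, hi]
    set S := ∑ i ∈ F, ‖c i‖ ^ 2 with hS
    have h1 : (inner ℂ v (∑ i ∈ F, c i • φ i) : ℂ) = (S : ℂ) := by
      rw [inner_sum, hS]
      push_cast
      refine Finset.sum_congr rfl fun i hi => ?_
      rw [inner_smul_right, ← inner_conj_symm, hvi i hi, Complex.mul_conj']
    have h2 : S ≤ ‖v‖ * ‖∑ i ∈ F, c i • φ i‖ := by
      have := norm_inner_le_norm (𝕜 := ℂ) v (∑ i ∈ F, c i • φ i)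
      rw [h1] at this
      exact (le_abs_self S).trans (by simpa using this)
    have h3 := hC v
    rw [hn] at h3
    have hS0 : 0 ≤ S := Finset.sum_nonneg fun _ _ => by positivity
    by_cases hSz : S = 0
    · rw [hSz]; simp
    · have hSp : 0 < S := lt_of_le_of_ne hS0 (Ne.symm hSz)
      have h4 : S ^ 2 ≤ ‖v‖ ^ 2 * ‖∑ i ∈ F, c i • φ i‖ ^ 2 := by
        rw [← mul_pow]; gcongr
      have h5 : A * S ^ 2 ≤ S * ‖∑ i ∈ F, c i • φ i‖ ^ 2 := by
        calc A * S ^ 2 ≤ A * (‖v‖ ^ 2 * ‖∑ i ∈ F, c i • φ i‖ ^ 2) := by gcongr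
          _ = (A * ‖v‖ ^ 2) * ‖∑ i ∈ F, c i • φ i‖ ^ 2 := by ring
          _ ≤ _ := by gcongr
      have : S * (A * S) ≤ S * ‖∑ i ∈ F, c i • φ i‖ ^ 2 := by linarith
      exact le_of_mul_le_mul_left this hSp
  refine ⟨A, hA, ?_, fun F u w hw hwu => ?_⟩
  · rw [linearIndependent_iff']
    intro F c hc i hi
    have h1 := key F c
    rw [hc, norm_zero] at h1
    have h2 : ‖c i‖ ^ 2 ≤ ∑ i ∈ F, ‖c i‖ ^ 2 :=
      Finset.single_le_sum (f := fun i => ‖c i‖ ^ 2) (fun _ _ => by positivity) hi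
    have h3 : ‖c i‖ ^ 2 ≤ 0 := by nlinarith
    simpa using le_antisymm h3 (by positivity)
  · obtain ⟨c, rfl⟩ : ∃ c : ι → ℂ, ∑ i ∈ F, c i • φ i = w := by
      obtain ⟨c, rfl⟩ := (Submodule.mem_span_image_finset_iff_exists_fun ℂ).1 hw
      exact ⟨fun i => if h : i ∈ F then c ⟨i, h⟩ else 0, by
        rw [← Finset.sum_coe_sort F]; simp⟩
    have h1 := key F c
    set w := ∑ i ∈ F, c i • φ i with hwdef
    -- The condition on `w` and `u` is the one met by the projection `w` of `u` to the span.
    have h2 : ‖w‖ ^ 2 ≤ ∑ i ∈ F, ‖c i‖ * ‖inner ℂ (φ i) u‖ := by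
      have : ‖w‖ ^ 2 = ‖(inner ℂ w u : ℂ)‖ := by rw [hwu]; simp
      rw [this, hwdef, sum_inner]
      refine (norm_sum_le _ _).trans (Finset.sum_le_sum fun i _ => ?_)
      rw [inner_smul_left, norm_mul, RCLike.norm_conj]
    have h3 := Finset.sum_mul_sq_le_sq_mul_sq F (fun i => ‖c i‖) (fun i => ‖inner ℂ (φ i) u‖)
    by_cases hw0 : ‖w‖ ^ 2 = 0
    · rw [hw0, mul_zero]; exact Finset.sum_nonneg fun _ _ => by positivity
    · have hwp : 0 < ‖w‖ ^ 2 := lt_of_le_of_ne (by positivity) (Ne.symm hw0)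
      refine le_of_mul_le_mul_left ?_ hwp
      have hT : 0 ≤ ∑ i ∈ F, ‖inner ℂ (φ i) u‖ ^ 2 := Finset.sum_nonneg fun _ _ => by positivity
      calc ‖w‖ ^ 2 * (A * ‖w‖ ^ 2) = A * (‖w‖ ^ 2) ^ 2 := by ring
        _ ≤ A * (∑ i ∈ F, ‖c i‖ * ‖inner ℂ (φ i) u‖) ^ 2 := by gcongr
        _ ≤ A * ((∑ i ∈ F, ‖c i‖ ^ 2) * ∑ i ∈ F, ‖inner ℂ (φ i) u‖ ^ 2) := by gcongr
        _ = (A * ∑ i ∈ F, ‖c i‖ ^ 2) * ∑ i ∈ F, ‖inner ℂ (φ i) u‖ ^ 2 := by ring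
        _ ≤ _ := by gcongr

end Frames

end CoherentFrames

namespace CoherentFrames

/-! ### Counting points through finite subsets. -/

section Counting

variable {G : Type*}

lemma encard_inter_le {Λ S : Set G} {b : ℝ≥0∞}
    (h : ∀ F : Finset Λ, (∀ l ∈ F, (l : G) ∈ S) → (F.card : ℝ≥0∞) ≤ b) :
    ((Λ ∩ S).encard : ℝ≥0∞) ≤ b := by
  have e : (Λ ∩ S).encard = {l : Λ | (l : G) ∈ S}.encard := by
    rw [← (Subtype.val_injective (p := fun l => l ∈ Λ)).encard_image]
    congr 1
    ext x
    simp [and_comm]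
  rw [e]
  by_cases hf : {l : Λ | (l : G) ∈ S}.Finite
  · rw [hf.encard_eq_coe_toFinset_card]
    simpa using h hf.toFinset (by simp)
  · have hinf : {l : Λ | (l : G) ∈ S}.Infinite := hf
    have hb : b = ∞ := by
      refine ENNReal.eq_top_of_forall_nnreal_le fun r => ?_
      obtain ⟨n, hn⟩ := exists_nat_ge r
      obtain ⟨F, hF, hc⟩ := hinf.exists_subset_card_eq n
      have := h F fun l hl => hF hl
      rw [hc] at this
      exact le_trans (by exact_mod_cast hn) this
    simp [hb]

lemma card_le_encard_inter {Λ S : Set G} (F : Finset Λ) (h : ∀ l ∈ F, (l : G) ∈ S) :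
    (F.card : ℝ≥0∞) ≤ ((Λ ∩ S).encard : ℝ≥0∞) := by
  have h1 : (F.card : ℕ∞) ≤ (Λ ∩ S).encard := by
    rw [← Set.encard_coe_eq_coe_finsetCard,
      ← (Subtype.val_injective (p := fun l => l ∈ Λ)).encard_image]
    refine Set.encard_le_encard ?_
    rintro _ ⟨l, hl, rfl⟩
    exact ⟨l.2, h l hl⟩
  calc (F.card : ℝ≥0∞) = ((F.card : ℕ∞) : ℝ≥0∞) := by simp
    _ ≤ _ := ENat.toENNReal_le.2 h1

lemma exists_finset_of_encard_ne_top {Λ S : Set G} (h : ((Λ ∩ S).encard : ℝ≥0∞) ≠ ∞) :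
    ∃ F : Finset Λ, (∀ l : Λ, l ∈ F ↔ (l : G) ∈ S) ∧
      (F.card : ℝ≥0∞) = ((Λ ∩ S).encard : ℝ≥0∞) := by
  have hf : (Λ ∩ S).Finite := by
    rw [← Set.encard_ne_top_iff]
    simpa using h
  have hf' : {l : Λ | (l : G) ∈ S}.Finite := by
    refine Set.Finite.of_finite_image (hf.subset ?_) Subtype.val_injective.injOn
    rintro _ ⟨l, hl, rfl⟩
    exact ⟨l.2, hl⟩
  refine ⟨hf'.toFinset, by simp, le_antisymm (card_le_encard_inter _ (by simp)) ?_⟩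
  refine encard_inter_le fun F hF => ?_
  exact_mod_cast Finset.card_le_card fun l hl => by simpa using hF l hl

end Counting

/-! ### Overlap and compactness estimates for integrals. -/

section Covering

variable {G : Type*} [Group G] [TopologicalSpace G] [IsTopologicalGroup G] [T2Space G]
    [LocallyCompactSpace G] [SecondCountableTopology G] [MeasurableSpace G] [BorelSpace G]
variable {μ : Measure G}

/-- If the translates `p i • V` of a symmetric set overlap at most `R` times, so do integrals. -/
lemma sum_setLIntegral_le {ι : Type*} {V : Set G} (hV : IsOpen V) (hsymm : V⁻¹ = V)
    {R : ℝ≥0∞} (F : Finset ι) (p : ι → G)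
    (hR : ∀ z, ∀ F' ⊆ F, (∀ i ∈ F', z⁻¹ * p i ∈ V) → (F'.card : ℝ≥0∞) ≤ R)
    {w : G → ℝ≥0∞} (hw : AEMeasurable w μ) {S : Set G} (hS : MeasurableSet S)
    (hsub : ∀ i ∈ F, p i • V ⊆ S) :
    ∑ i ∈ F, ∫⁻ z in p i • V, w z ∂μ ≤ R * ∫⁻ z in S, w z ∂μ := by
  classical
  have hm : ∀ i, MeasurableSet (p i • V) := fun i => (hV.smul (p i)).measurableSet
  have hpt : ∀ z, ∑ i ∈ F, (p i • V).indicator w z ≤ R * S.indicator w z := by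
    intro z
    by_cases hz : z ∈ S
    · rw [Set.indicator_of_mem hz]
      have h1 : ∑ i ∈ F, (p i • V).indicator w z =
          (F.filter fun i => z⁻¹ * p i ∈ V).card * w z := by
        rw [← nsmul_eq_mul, ← Finset.sum_const, Finset.sum_filter]
        refine Finset.sum_congr rfl fun i _ => ?_
        rw [Set.indicator_apply]
        congr 1
        rw [Set.mem_smul_set_iff_inv_smul_mem, smul_eq_mul]
        conv_lhs => rw [← hsymm, Set.mem_inv, mul_inv_rev, inv_inv]
      rw [h1]
      gcongr
      exact hR z _ (Finset.filter_subset _ _) fun i hi => (Finset.mem_filter.1 hi).2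
    · rw [Finset.sum_eq_zero]
      · exact zero_le
      · intro i hi
        exact Set.indicator_of_notMem (fun h => hz (hsub i hi h)) _
  calc ∑ i ∈ F, ∫⁻ z in p i • V, w z ∂μ = ∑ i ∈ F, ∫⁻ z, (p i • V).indicator w z ∂μ := by
        simp only [lintegral_indicator (hm _)]
    _ = ∫⁻ z, ∑ i ∈ F, (p i • V).indicator w z ∂μ :=
        (lintegral_finsetSum' _ fun i _ => hw.indicator (hm i)).symm
    _ ≤ ∫⁻ z, R * S.indicator w z ∂μ := lintegral_mono hpt
    _ = R * ∫⁻ z in S, w z ∂μ := by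
        rw [lintegral_const_mul'' _ (hw.indicator hS), lintegral_indicator hS]

/-- An integrable function has small mass outside a large compact set. -/
lemma exists_isCompact_setLIntegral_compl_le [SFinite μ] {w : G → ℝ≥0∞} (hw : ∫⁻ z, w z ∂μ ≠ ∞)
    {ε : ℝ≥0∞} (hε : ε ≠ 0) :
    ∃ C : Set G, IsCompact C ∧ C.Nonempty ∧ ∫⁻ z in Cᶜ, w z ∂μ ≤ ε := by
  have hfin : IsFiniteMeasure (μ.withDensity w) := isFiniteMeasure_withDensity hw
  have hmeas : ∀ n, MeasurableSet (compactCovering G n)ᶜ := fun n =>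
    (isCompact_compactCovering G n).measurableSet.compl
  have hlim : Tendsto (fun n => μ.withDensity w (compactCovering G n)ᶜ) atTop (𝓝 0) := by
    have h := tendsto_measure_iInter_atTop (μ := μ.withDensity w)
      (s := fun n => (compactCovering G n)ᶜ) (fun n => (hmeas n).nullMeasurableSet)
      (fun m n hmn => Set.compl_subset_compl.2 (compactCovering_subset G hmn))
      ⟨0, measure_ne_top _ _⟩
    have h2 : ⋂ n, (compactCovering G n)ᶜ = ∅ := by
      rw [← Set.compl_iUnion, iUnion_compactCovering, Set.compl_univ]
    rw [h2, measure_empty] at h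
    exact h
  obtain ⟨n, hn⟩ := (hlim.eventually (gt_mem_nhds (pos_iff_ne_zero.2 hε))).exists
  refine ⟨compactCovering G n ∪ {1}, (isCompact_compactCovering G n).union isCompact_singleton,
    ⟨1, by simp⟩, ?_⟩
  rw [withDensity_apply _ (hmeas n)] at hn
  refine le_trans (lintegral_mono_set ?_) hn.le
  exact Set.compl_subset_compl.2 Set.subset_union_left

/-- A relatively separated set has at most `κ μ(S V)` points in `S`. -/
lemma encard_inter_le_of_overlap [μ.IsMulLeftInvariant] {Λ V : Set G} (hV : IsOpen V)
    (hsymm : V⁻¹ = V) {R : ℝ≥0∞}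
    (hR : ∀ (z : G) (F : Finset Λ), (∀ l ∈ F, z⁻¹ * l ∈ V) → (F.card : ℝ≥0∞) ≤ R)
    (hV0 : μ V ≠ 0) (hVtop : μ V ≠ ∞) (S : Set G) :
    ((Λ ∩ S).encard : ℝ≥0∞) ≤ R / μ V * μ (S * V) := by
  refine encard_inter_le fun F hF => ?_
  -- With weight `1`, bounded overlap says `F.card * μ V ≤ R * μ (S * V)`.
  have h := sum_setLIntegral_le (μ := μ) hV hsymm F (fun l : Λ => (l : G))
    (fun z F' _ hF' => hR z F' hF') (w := fun _ => 1) aemeasurable_const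
    (S := S * V) (hV.mul_left).measurableSet (fun l hl => by
      rintro _ ⟨v, hv, rfl⟩
      exact Set.mul_mem_mul (hF l hl) hv)
  simp only [lintegral_const, one_mul, Measure.restrict_apply_univ, measure_smul,
    Finset.sum_const, nsmul_eq_mul] at h
  rw [ENNReal.mul_comm_div, ← mul_div_assoc]
  exact (ENNReal.le_div_iff_mul_le (Or.inl hV0) (Or.inl hVtop)).2 h

end Covering

end CoherentFrames

namespace CoherentFrames

/-! ### Beurling densities along Følner sequences. -/

section Density

variable {G : Type*} [Group G] [TopologicalSpace G] [IsTopologicalGroup G] [T2Space G]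
    [LocallyCompactSpace G] [SecondCountableTopology G] [MeasurableSpace G] [BorelSpace G]
variable {μ : Measure G} [μ.IsHaarMeasure] [μ.IsInvInvariant]

lemma measure_mul_div_le {K C : Set G} (h0 : μ K ≠ 0) (htop : μ K ≠ ∞) :
    μ (K * C) / μ K ≤ 1 + μ (symmDiff (K * C) K) / μ K := by
  rw [← ENNReal.div_self h0 htop, ← ENNReal.add_div]
  gcongr
  refine (measure_mono ?_).trans (measure_union_le K (symmDiff (K * C) K))
  intro x hx
  by_cases hK : x ∈ K
  · exact Or.inl hK
  · exact Or.inr (Or.inl ⟨hx, hK⟩)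

/-- Averaging over `x K`: the least number of points in translates of `L` is controlled by the
number of points in `x K L`. -/
lemma iInf_encard_mul_le {Λ K L : Set G} (hK : IsCompact K) (hL : IsCompact L) (hL0 : μ L ≠ 0)
    (x : G) :
    (⨅ y : G, ((Λ ∩ y • L).encard : ℝ≥0∞)) * μ K ≤
      ((Λ ∩ x • (K * L)).encard : ℝ≥0∞) * μ L := by
  classical
  by_cases htop : ((Λ ∩ x • (K * L)).encard : ℝ≥0∞) = ∞
  · rw [htop, ENNReal.top_mul hL0]; exact le_top
  obtain ⟨F, hF, hcard⟩ := exists_finset_of_encard_ne_top htop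
  have hm : ∀ l : Λ, MeasurableSet ((l : G) • L⁻¹) := fun l => (hL.inv.smul (l : G)).measurableSet
  have hxK : MeasurableSet (x • K) := (hK.smul x).measurableSet
  -- Double counting: `l ∈ y • L` means `y ∈ l • L⁻¹`, a set of measure `μ L` by unimodularity.
  have hpt : ∀ y ∈ x • K, (⨅ y : G, ((Λ ∩ y • L).encard : ℝ≥0∞)) ≤
      ∑ l ∈ F, ((l : G) • L⁻¹).indicator 1 y := by
    intro y hy
    refine (iInf_le _ y).trans (encard_inter_le fun F' hF' => ?_)
    have hsub : F' ⊆ F := by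
      intro l hl
      rw [hF]
      have := Set.mul_mem_mul hy (Set.mem_smul_set_iff_inv_smul_mem.1 (hF' l hl))
      rw [smul_eq_mul, mul_inv_cancel_left] at this
      rwa [smul_mul_assoc] at this
    calc (F'.card : ℝ≥0∞) = ∑ l ∈ F', 1 := by simp
      _ = ∑ l ∈ F', ((l : G) • L⁻¹).indicator 1 y := by
        refine Finset.sum_congr rfl fun l hl => ?_
        rw [Set.indicator_of_mem]
        · rfl
        · have := Set.mem_smul_set_iff_inv_smul_mem.1 (hF' l hl)
          rw [Set.mem_smul_set_iff_inv_smul_mem, Set.mem_inv]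
          simpa using this
      _ ≤ _ := Finset.sum_le_sum_of_subset hsub
  calc (⨅ y : G, ((Λ ∩ y • L).encard : ℝ≥0∞)) * μ K
      = ∫⁻ y in x • K, (⨅ y : G, ((Λ ∩ y • L).encard : ℝ≥0∞)) ∂μ := by
        rw [setLIntegral_const, measure_smul]
    _ ≤ ∫⁻ y in x • K, ∑ l ∈ F, ((l : G) • L⁻¹).indicator 1 y ∂μ := setLIntegral_mono' hxK hpt
    _ ≤ ∫⁻ y, ∑ l ∈ F, ((l : G) • L⁻¹).indicator 1 y ∂μ := setLIntegral_le_lintegral _ _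
    _ = ∑ l ∈ F, μ L := by
        rw [lintegral_finsetSum _ fun l _ => measurable_one.indicator (hm l)]
        refine Finset.sum_congr rfl fun l _ => ?_
        rw [lintegral_indicator_one (hm l), measure_smul, Measure.measure_inv]
    _ = _ := by rw [Finset.sum_const, nsmul_eq_mul, hcard]

variable {Λ V Q : Set G} {κ : ℝ≥0∞}

/-- Enlarging `K` to `K C` adds at most a boundary term to the number of points. -/
lemma encard_inter_mul_le (hVQ : V ⊆ Q)
    (hcount : ∀ S : Set G, ((Λ ∩ S).encard : ℝ≥0∞) ≤ κ * μ (S * V)) (K C : Set G) (x : G) :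
    ((Λ ∩ x • (K * C)).encard : ℝ≥0∞) ≤ ((Λ ∩ x • K).encard : ℝ≥0∞) +
      κ * μ ((K * (C * Q ∪ Q)) ∩ (Kᶜ * (C * Q ∪ Q))) := by
  have h1 : Λ ∩ x • (K * C) ⊆ (Λ ∩ x • K) ∪ (Λ ∩ x • ((K * C) \ K)) := by
    rintro z ⟨hz, w, hw, rfl⟩
    by_cases hwK : w ∈ K
    · exact Or.inl ⟨hz, w, hwK, rfl⟩
    · exact Or.inr ⟨hz, w, ⟨hw, hwK⟩, rfl⟩
  calc ((Λ ∩ x • (K * C)).encard : ℝ≥0∞)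
      ≤ (((Λ ∩ x • K).encard + (Λ ∩ x • ((K * C) \ K)).encard : ℕ∞) : ℝ≥0∞) :=
        ENat.toENNReal_le.2 ((Set.encard_le_encard h1).trans (Set.encard_union_le _ _))
    _ = ((Λ ∩ x • K).encard : ℝ≥0∞) + ((Λ ∩ x • ((K * C) \ K)).encard : ℝ≥0∞) := by simp
    _ ≤ ((Λ ∩ x • K).encard : ℝ≥0∞) + κ * μ (x • ((K * C) \ K) * V) := by
        gcongr; exact hcount _
    _ ≤ _ := by
        gcongr _ + κ * ?_
        rw [smul_mul_assoc, measure_smul]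
        refine measure_mono ?_
        rintro _ ⟨w, ⟨⟨k, hk, c, hc, rfl⟩, hw⟩, v, hv, rfl⟩
        -- The point `k c v` is read as `k (c v)` and as `(k c) v`, so the boundary set needs both
        -- `C * Q` and `Q`.
        refine ⟨⟨k, hk, c * v, Or.inl ⟨c, hc, v, hVQ hv, rfl⟩, ?_⟩, ⟨k * c, hw, v, Or.inr (hVQ hv), rfl⟩⟩
        simp [mul_assoc]

variable (μ Λ) in
/-- The supremum over all non-null compact sets of the smallest count ratio. -/
noncomputable def lowerDensity : ℝ≥0∞ :=
  ⨆ (L : Set G) (_ : IsCompact L) (_ : μ L ≠ 0), ⨅ x : G, countRatio μ Λ L x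

lemma iInf_countRatio_le_lowerDensity {L : Set G} (hL : IsCompact L) (h0 : μ L ≠ 0) :
    ⨅ x : G, countRatio μ Λ L x ≤ lowerDensity μ Λ :=
  le_iSup₂_of_le L hL (le_iSup_of_le h0 le_rfl)

/-- Averaging over `K` counts points in `x K L`, and passing back to `x K` costs a boundary term.
Along a strong Følner sequence this term disappears, whatever the fixed `L`. -/
lemma iInf_countRatio_le_add (hVQ : V ⊆ Q)
    (hcount : ∀ S : Set G, ((Λ ∩ S).encard : ℝ≥0∞) ≤ κ * μ (S * V)) {K L : Set G}
    (hK : IsCompact K) (hK0 : μ K ≠ 0) (hL : IsCompact L) (hL0 : μ L ≠ 0) :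
    ⨅ x : G, countRatio μ Λ L x ≤ (⨅ x : G, countRatio μ Λ K x) +
      κ * (μ ((K * (L * Q ∪ Q)) ∩ (Kᶜ * (L * Q ∪ Q))) / μ K) := by
  have hKt := hK.measure_ne_top (μ := μ)
  have hLt := hL.measure_ne_top (μ := μ)
  rw [ENNReal.iInf_add]
  refine le_iInf fun x => ?_
  have h1 := iInf_encard_mul_le (Λ := Λ) hK hL hL0 x
  have h2 : ⨅ x : G, countRatio μ Λ L x = (⨅ y : G, ((Λ ∩ y • L).encard : ℝ≥0∞)) / μ L := by
    simp only [countRatio, div_eq_mul_inv]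
    rw [ENNReal.iInf_mul_of_ne (by simpa using hLt) (by simpa using hL0)]
  rw [h2, countRatio, ← mul_div_assoc, ← ENNReal.add_div,
    ENNReal.div_le_iff hL0 hLt, ← ENNReal.mul_div_right_comm,
    ENNReal.le_div_iff_mul_le (Or.inl hK0) (Or.inl hKt)]
  refine h1.trans ?_
  gcongr
  exact encard_inter_mul_le hVQ hcount K L x

/-- For a relatively separated set, the lower Beurling density exists along every strong Følner
sequence and equals `lowerDensity`. -/
lemma hasLowerBeurlingDensity_lowerDensity (hQ : IsCompact Q) (hVQ : V ⊆ Q) (hκ : κ ≠ ∞)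
    (hcount : ∀ S : Set G, ((Λ ∩ S).encard : ℝ≥0∞) ≤ κ * μ (S * V)) :
    HasLowerBeurlingDensity μ Λ (lowerDensity μ Λ) := by
  intro K hK
  refine tendsto_order.2 ⟨fun b hb => ?_, fun b hb => Eventually.of_forall fun n =>
    (iInf_countRatio_le_lowerDensity (hK.isCompact n) (hK.measure_ne_zero n)).trans_lt hb⟩
  simp only [lowerDensity, lt_iSup_iff] at hb
  obtain ⟨L, hL, hL0, hb⟩ := hb
  obtain ⟨δ, hδ, hbδ⟩ := ENNReal.lt_iff_exists_add_pos_lt.1 hb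
  have hlim := ENNReal.Tendsto.const_mul (a := κ)
    (hK.tendsto_boundary (L * Q ∪ Q) ((hL.mul hQ).union hQ)) (Or.inr hκ)
  rw [mul_zero] at hlim
  filter_upwards [hlim.eventually (gt_mem_nhds (show (0 : ℝ≥0∞) < δ by exact_mod_cast hδ))]
    with n hn
  by_contra! hle
  have := iInf_countRatio_le_add hVQ hcount (hK.isCompact n) (hK.measure_ne_zero n) hL hL0
  exact absurd (hbδ.trans_le (this.trans (add_le_add hle hn.le))) (lt_irrefl _)

/-- The supremum in `lowerDensity` is tested on `K n * C`, whose measure is asymptotically that of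
`K n`; a plain Følner sequence is enough. -/
lemma le_lowerDensity (hG : IsAmenable μ) {d : ℝ}
    (h : ∀ ε : ℝ, 0 < ε → ε < 1 → ∃ C : Set G, IsCompact C ∧ C.Nonempty ∧ ∀ K : Set G,
      IsCompact K → ∀ x : G,
        ENNReal.ofReal (d * (1 - ε)) * μ K ≤ ((Λ ∩ x • (K * C)).encard : ℝ≥0∞)) :
    ENNReal.ofReal d ≤ lowerDensity μ Λ := by
  by_cases hD : lowerDensity μ Λ = ∞
  · rw [hD]; exact le_top
  obtain ⟨K, hK⟩ := hG
  have hε : ∀ ε : ℝ, 0 < ε → ε < 1 → ENNReal.ofReal (d * (1 - ε)) ≤ lowerDensity μ Λ := by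
    intro ε h0 h1
    obtain ⟨C, hC, hCne, hKC⟩ := h ε h0 h1
    have hlim : Tendsto (fun n => lowerDensity μ Λ *
        (1 + μ (symmDiff (K n * C) (K n)) / μ (K n))) atTop (𝓝 (lowerDensity μ Λ)) := by
      have := ENNReal.Tendsto.const_mul (a := lowerDensity μ Λ)
        ((hK.tendsto_symmDiff C hC hCne).const_add 1) (Or.inr hD)
      simpa using this
    refine ge_of_tendsto' hlim fun n => ?_
    have hn0 := hK.measure_ne_zero n
    have hnt := (hK.isCompact n).measure_ne_top (μ := μ)
    have hc : IsCompact (K n * C) := (hK.isCompact n).mul hC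
    have hct := hc.measure_ne_top (μ := μ)
    have hc0 : μ (K n * C) ≠ 0 := by
      obtain ⟨c, hcC⟩ := hCne
      have h2 : μ (K n * {c}) = μ (K n) := by
        rw [← Measure.measure_inv, mul_inv_rev, Set.inv_singleton, ← smul_eq_mul,
          Set.singleton_smul,
          measure_smul, Measure.measure_inv]
      have h3 : μ (K n) ≤ μ (K n * C) := by
        rw [← h2]
        exact measure_mono (Set.mul_subset_mul_left (Set.singleton_subset_iff.2 hcC))
      exact fun h0 => hn0 (le_antisymm (h3.trans_eq h0) zero_le)
    refine le_trans ?_ (mul_le_mul_right (measure_mul_div_le hn0 hnt) _)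
    rw [← mul_div_assoc, ENNReal.le_div_iff_mul_le (Or.inl hn0) (Or.inl hnt)]
    have h2 := iInf_countRatio_le_lowerDensity (Λ := Λ) hc hc0
    rw [← ENNReal.div_le_iff hc0 hct]
    refine le_trans (le_iInf fun x => ?_) h2
    rw [countRatio]
    gcongr
    exact hKC _ (hK.isCompact n) x
  have hcont : Continuous fun ε : ℝ => ENNReal.ofReal (d * (1 - ε)) :=
    ENNReal.continuous_ofReal.comp (by fun_prop)
  have hlim : Tendsto (fun ε : ℝ => ENNReal.ofReal (d * (1 - ε))) (𝓝[>] 0)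
      (𝓝 (ENNReal.ofReal d)) := by
    simpa using (hcont.tendsto 0).mono_left nhdsWithin_le_nhds
  refine le_of_tendsto hlim ?_
  filter_upwards [Ioo_mem_nhdsGT (show (0 : ℝ) < 1 by norm_num)] with ε hε'
  exact hε ε hε'.1 hε'.2

/-- The infimum is at most the supremum, so the lower density bounds the limit from below; only the
bound from above uses `h`. -/
lemma hasUpperBeurlingDensity_of_le {d : ℝ}
    (hlow : ∃ D, HasLowerBeurlingDensity μ Λ D ∧ ENNReal.ofReal d ≤ D)
    (h : ∀ ε : ℝ, 0 < ε → ε < 1 → ∃ C : Set G, IsCompact C ∧ C.Nonempty ∧ ∀ K : Set G,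
      IsCompact K → ∀ x : G,
        ((Λ ∩ x • K).encard : ℝ≥0∞) ≤ ENNReal.ofReal (d * (1 + ε)) * μ (K * C)) :
    HasUpperBeurlingDensity μ Λ (ENNReal.ofReal d) := by
  obtain ⟨D, hD, hdD⟩ := hlow
  intro K hK
  refine tendsto_order.2 ⟨fun b hb => ?_, fun b hb => ?_⟩
  · filter_upwards [(hD K hK).eventually (lt_mem_nhds (hb.trans_le hdD))] with n hn
    exact hn.trans_le ((iInf_le _ 1).trans (le_iSup (countRatio μ Λ (K n)) 1))
  · obtain ⟨ε, h0, h1, hεb⟩ : ∃ ε : ℝ, 0 < ε ∧ ε < 1 ∧ ENNReal.ofReal (d * (1 + ε)) < b := by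
      have hcont : Continuous fun ε : ℝ => ENNReal.ofReal (d * (1 + ε)) :=
        ENNReal.continuous_ofReal.comp (by fun_prop)
      have hlim : Tendsto (fun ε : ℝ => ENNReal.ofReal (d * (1 + ε))) (𝓝[>] 0)
          (𝓝 (ENNReal.ofReal d)) := by
        simpa using (hcont.tendsto 0).mono_left nhdsWithin_le_nhds
      obtain ⟨ε, hεb, hε⟩ := ((hlim.eventually (gt_mem_nhds hb)).and
        (Ioo_mem_nhdsGT (zero_lt_one' ℝ))).exists
      exact ⟨ε, hε.1, hε.2, hεb⟩
    obtain ⟨C, hC, hCne, hKC⟩ := h ε h0 h1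
    have hlim : Tendsto (fun n => ENNReal.ofReal (d * (1 + ε)) *
        (1 + μ (symmDiff (K n * C) (K n)) / μ (K n))) atTop
          (𝓝 (ENNReal.ofReal (d * (1 + ε)))) := by
      have := ENNReal.Tendsto.const_mul (a := ENNReal.ofReal (d * (1 + ε)))
        ((hK.tendsto_symmDiff C hC hCne).const_add 1) (Or.inr ENNReal.ofReal_ne_top)
      simpa using this
    filter_upwards [hlim.eventually (gt_mem_nhds hεb)] with n hn
    refine lt_of_le_of_lt (iSup_le fun x => ?_) hn
    have hn0 := hK.measure_ne_zero n
    have hnt := (hK.isCompact n).measure_ne_top (μ := μ)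
    refine le_trans ?_ (mul_le_mul_right (measure_mul_div_le hn0 hnt) _)
    rw [← mul_div_assoc, countRatio]
    gcongr
    exact hKC _ (hK.isCompact n) x

end Density

end CoherentFrames

namespace CoherentFrames

/-! ### Trace formula, localization and the two counting estimates. -/

section Coherent

variable {G : Type*} [Group G] [TopologicalSpace G] [IsTopologicalGroup G] [T2Space G]
    [LocallyCompactSpace G] [SecondCountableTopology G] [MeasurableSpace G] [BorelSpace G]
variable {H : Type*} [NormedAddCommGroup H] [InnerProductSpace ℂ H] {π : G → H ≃ₗᵢ[ℂ] H}
variable {μ : Measure G} [μ.IsHaarMeasure] [μ.IsInvInvariant]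

lemma enorm_sq_eq_ofReal {E : Type*} [NormedAddCommGroup E] (v : E) :
    ‖v‖ₑ ^ 2 = ENNReal.ofReal (‖v‖ ^ 2) := by
  rw [← ofReal_norm, ENNReal.ofReal_pow (norm_nonneg _)]

lemma IsFormalDegree.lintegral_coeff {d : ℝ} (hd : IsFormalDegree μ π d) (g f : H) :
    ∫⁻ x, ENNReal.ofReal (‖coeff π g f x‖ ^ 2) ∂μ =
      ENNReal.ofReal (d⁻¹ * ‖f‖ ^ 2 * ‖g‖ ^ 2) := by
  obtain ⟨hint, heq⟩ := hd.2 f f g g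
  have e : ∀ x, coeff π g f x * inner ℂ f (π x g) = ((‖coeff π g f x‖ ^ 2 : ℝ) : ℂ) := by
    intro x
    rw [← inner_conj_symm, Complex.ofReal_pow, ← Complex.mul_conj']
    rfl
  simp only [e] at hint heq
  have hint' : Integrable (fun x => ‖coeff π g f x‖ ^ 2) μ := by
    exact hint.re
  rw [← ofReal_integral_eq_lintegral_ofReal hint' (Eventually.of_forall fun x => by positivity)]
  congr 1
  rw [integral_complex_ofReal] at heq
  simp only [inner_self_eq_norm_sq_to_K] at heq
  have h2 : ((∫ x, ‖coeff π g f x‖ ^ 2 ∂μ : ℝ) : ℂ) = ((d⁻¹ * ‖f‖ ^ 2 * ‖g‖ ^ 2 : ℝ) : ℂ) := by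
    rw [heq]
    simp
  exact_mod_cast h2

/-- The trace of the compression of `∫ π(y) g ⊗ π(y) g dμ(y)` to a finite-dimensional subspace. -/
lemma IsFormalDegree.lintegral_norm_sq_starProjection (hπ : IsProjectiveRep π) {d : ℝ}
    (hd : IsFormalDegree μ π d) (g : H) (W : Submodule ℂ H) [FiniteDimensional ℂ W] :
    ∫⁻ y, ENNReal.ofReal (‖W.starProjection (π y g)‖ ^ 2) ∂μ =
      Module.finrank ℂ W * ENNReal.ofReal (d⁻¹ * ‖g‖ ^ 2) := by
  let b := stdOrthonormalBasis ℂ W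
  have h : ∀ y, ENNReal.ofReal (‖W.starProjection (π y g)‖ ^ 2) =
      ∑ i, ENNReal.ofReal (‖coeff π g (b i : H) y‖ ^ 2) := by
    intro y
    rw [← ENNReal.ofReal_sum_of_nonneg fun _ _ => by positivity]
    congr 1
    have h1 := b.sum_sq_norm_inner_left (W.orthogonalProjectionOnto (π y g))
    have h2 : ‖W.starProjection (π y g)‖ = ‖W.orthogonalProjectionOnto (π y g)‖ := rfl
    rw [h2, ← h1]
    refine Finset.sum_congr rfl fun i _ => ?_
    rw [Submodule.coe_inner, coeff]
    congr 2
    have := W.starProjection_inner_eq_zero (π y g) (b i) (b i).2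
    rw [inner_sub_left, sub_eq_zero] at this
    exact this.symm
  simp only [h]
  rw [lintegral_finsetSum _ fun i _ =>
    ((hπ.stronglyMeasurable_coeff g (b i : H)).norm.measurable.pow_const 2).ennreal_ofReal]
  simp only [hd.lintegral_coeff]
  have hb : ∀ i, ‖(b i : H)‖ = 1 := fun i => b.orthonormal.1 i
  simp [hb]

variable {Λ : Set G} {g : H}

lemma norm_inner_coherentSystem (hπ : IsProjectiveRep π) (l : Λ) (y : G) :
    ‖inner ℂ (coherentSystem π Λ g l) (π y g)‖ = ‖coeff π g g (y⁻¹ * l)‖ :=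
  hπ.norm_inner_apply_apply _ _ _ _

/-- The index set of a coherent frame is relatively separated. -/
lemma exists_overlap_bound (hπ : IsProjectiveRep π) (hg : g ≠ 0) {Q : Set G} (hQ : Q ∈ 𝓝 (1 : G))
    (μ : Measure G) [μ.IsHaarMeasure] [μ.IsInvInvariant]
    (hfr : IsFrame (coherentSystem π Λ g)) :
    ∃ (V : Set G) (R : ℝ≥0∞), IsOpen V ∧ (1 : G) ∈ V ∧ V⁻¹ = V ∧ V ⊆ interior Q ∧ R ≠ ∞ ∧
      ∀ (z : G) (F : Finset Λ), (∀ l ∈ F, z⁻¹ * l ∈ V) → (F.card : ℝ≥0∞) ≤ R := by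
  obtain ⟨B, hB, hbes⟩ := hfr.bessel
  have hgn : 0 < ‖g‖ ^ 2 := by positivity
  -- Each `l` near `z` contributes at least `(‖g‖ ^ 2 / 2) ^ 2` to the Bessel sum of `π z g`, which
  -- bounds their number.
  have hU : {x | ‖g‖ ^ 2 / 2 < ‖coeff π g g x‖} ∈ 𝓝 (1 : G) := by
    refine (hπ.continuous_norm_coeff μ g g).continuousAt.eventually (lt_mem_nhds ?_)
    simp only [hπ.norm_coeff_one]
    linarith
  set V₀ := interior ({x | ‖g‖ ^ 2 / 2 < ‖coeff π g g x‖} ∩ Q)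
  have h1 : (1 : G) ∈ V₀ := mem_interior_iff_mem_nhds.2 (inter_mem hU hQ)
  refine ⟨V₀ ∩ V₀⁻¹, ENNReal.ofReal (B * ‖g‖ ^ 2 / (‖g‖ ^ 2 / 2) ^ 2),
    isOpen_interior.inter isOpen_interior.inv, ⟨h1, by simpa using h1⟩, ?_,
    Set.inter_subset_left.trans (interior_mono Set.inter_subset_right), ENNReal.ofReal_ne_top, ?_⟩
  · rw [Set.inter_inv, inv_inv, Set.inter_comm]
  · intro z F hF
    have h2 := hbes (π z g) F
    rw [LinearIsometryEquiv.norm_map] at h2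
    have h3 : (F.card : ℝ) * (‖g‖ ^ 2 / 2) ^ 2 ≤
        ∑ l ∈ F, ‖inner ℂ (coherentSystem π Λ g l) (π z g)‖ ^ 2 := by
      rw [← nsmul_eq_mul]
      refine Finset.card_nsmul_le_sum _ _ _ fun l hl => ?_
      rw [norm_inner_coherentSystem hπ]
      have := (interior_subset (hF l hl).1).1
      gcongr
      exact le_of_lt this
    rw [← ENNReal.ofReal_natCast]
    refine ENNReal.ofReal_le_ofReal ?_
    rw [le_div_iff₀ (by positivity)]
    exact h3.trans h2

/-- Point values are controlled by the local maximal function nearby. -/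
lemma ofReal_norm_sq_le_localMaximal {F : G → ℂ} (hF : Continuous fun x => ‖F x‖) {Q : Set G}
    {z q : G} (hq : q ∈ interior Q) :
    ENNReal.ofReal (‖F (z * q)‖ ^ 2) ≤ localMaximal μ Q F z ^ 2 := by
  rw [← enorm_sq_eq_ofReal]
  gcongr
  by_contra! hlt
  -- By continuity, one excessive value gives a non-empty open set of them inside `Q`, against the
  -- essential supremum.
  set O := {x | localMaximal μ Q F z < ‖F (z * x)‖ₑ} ∩ interior Q
  have hO : IsOpen O := by
    refine IsOpen.inter ?_ isOpen_interior
    have hc : Continuous fun x => ‖F (z * x)‖ₑ := by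
      simp only [← ofReal_norm]
      exact ENNReal.continuous_ofReal.comp (hF.comp (continuous_const_mul z))
    exact isOpen_lt continuous_const hc
  have hpos : 0 < μ O := hO.measure_pos μ ⟨q, hlt, hq⟩
  have hae := ae_le_essSup (μ := μ.restrict Q) (f := fun x => ‖F (z * x)‖ₑ)
  have h0 : μ.restrict Q O = 0 := by
    refine measure_mono_null ?_ hae
    intro x hx hle
    have h1 : localMaximal μ Q F z < ‖F (z * x)‖ₑ := hx.1
    exact absurd hle (not_le.2 h1)
  rw [Measure.restrict_apply hO.measurableSet, Set.inter_eq_left.2] at h0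
  · exact hpos.ne' h0
  · exact Set.inter_subset_right.trans interior_subset

/-- The frame coefficients of `π(y) g` are small far away from `y`, uniformly in `y`. -/
lemma exists_sum_tail_le (hπ : IsProjectiveRep π) {Q V : Set G} (hQc : IsCompact Q)
    (hV : IsOpen V) (hV1 : (1 : G) ∈ V) (hsymm : V⁻¹ = V) (hVQ : V ⊆ interior Q)
    {R : ℝ≥0∞} (hRtop : R ≠ ∞)
    (hR : ∀ (z : G) (F : Finset Λ), (∀ l ∈ F, z⁻¹ * l ∈ V) → (F.card : ℝ≥0∞) ≤ R)
    (hgB : g ∈ B2 μ Q π) {ε : ℝ} (hε : 0 < ε) :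
    ∃ C : Set G, IsCompact C ∧ C.Nonempty ∧ ∀ (y : G) (F : Finset Λ),
      (∀ l ∈ F, y⁻¹ * l ∉ C) →
        ∑ l ∈ F, ‖inner ℂ (coherentSystem π Λ g l) (π y g)‖ ^ 2 ≤ ε := by
  have hM := hgB.memLp
  set M := localMaximal μ Q (coeff π g g)
  have hMm : AEMeasurable (fun z => M z ^ 2) μ := (hM.1.aemeasurable).pow_const 2
  have hMint : ∫⁻ z, M z ^ 2 ∂μ ≠ ∞ := by
    have := hM.2
    rw [eLpNorm_lt_top_iff_lintegral_rpow_enorm_lt_top (by norm_num) (by norm_num)] at this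
    simpa using this.ne
  have hV0 : μ V ≠ 0 := (hV.measure_pos μ ⟨1, hV1⟩).ne'
  have hVtop : μ V ≠ ∞ := ((measure_mono (hVQ.trans interior_subset)).trans_lt
    hQc.measure_lt_top).ne
  obtain ⟨η, hη0, hη⟩ : ∃ η : ℝ≥0∞, η ≠ 0 ∧ R * η ≤ ENNReal.ofReal ε * μ V := by
    -- `R + 1` avoids dividing by zero.
    refine ⟨ENNReal.ofReal ε * μ V / (R + 1), ?_, ?_⟩
    · refine (ENNReal.div_pos (mul_ne_zero ?_ hV0) (by finiteness)).ne'
      simpa using hε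
    · rw [← mul_div_assoc]
      refine ENNReal.div_le_of_le_mul ?_
      rw [mul_comm]
      gcongr
      exact le_self_add
  obtain ⟨C, hC, hCne, hCint⟩ := exists_isCompact_setLIntegral_compl_le hMint hη0
  -- The margin `Q` keeps each `(y⁻¹ * l) • V` off `C`. There the maximal function bounds the
  -- coefficient at `y⁻¹ * l`, so the sum is controlled by its tail integral.
  refine ⟨C * Q, hC.mul hQc, hCne.mul ⟨1, interior_subset (hVQ hV1)⟩, fun y F hF => ?_⟩
  have h1 := sum_setLIntegral_le (μ := μ) hV hsymm F (fun l : Λ => y⁻¹ * l)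
    (R := R) (fun z F' _ hF' => hR (y * z) F' fun l hl => by
      simpa [mul_assoc] using hF' l hl) hMm hC.measurableSet.compl (fun l hl => by
      rintro _ ⟨v, hv, rfl⟩ hvC
      refine hF l hl ⟨_, hvC, v⁻¹, interior_subset (hVQ ?_), by simp⟩
      rw [← hsymm]
      simpa using hv)
  have h2 : ∀ l ∈ F, ENNReal.ofReal (‖inner ℂ (coherentSystem π Λ g l) (π y g)‖ ^ 2) * μ V ≤
      ∫⁻ z in (y⁻¹ * (l : G)) • V, M z ^ 2 ∂μ := by
    intro l _
    rw [norm_inner_coherentSystem hπ, ← measure_smul μ (y⁻¹ * (l : G)) V, ← setLIntegral_const]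
    refine setLIntegral_mono' (hV.smul _).measurableSet ?_
    rintro _ ⟨v, hv, rfl⟩
    have hv' : v⁻¹ ∈ interior Q := hVQ (by rw [← hsymm]; simpa using hv)
    have := ofReal_norm_sq_le_localMaximal (μ := μ) (hπ.continuous_norm_coeff μ g g)
      (z := (y⁻¹ * (l : G)) * v) hv'
    rwa [mul_inv_cancel_right] at this
  have h3 : ENNReal.ofReal (∑ l ∈ F, ‖inner ℂ (coherentSystem π Λ g l) (π y g)‖ ^ 2) * μ V ≤
      ENNReal.ofReal ε * μ V := by
    rw [ENNReal.ofReal_sum_of_nonneg fun _ _ => by positivity, Finset.sum_mul]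
    refine (Finset.sum_le_sum h2).trans (h1.trans (le_trans ?_ hη))
    gcongr
  rw [ENNReal.mul_le_mul_iff_left hV0 hVtop] at h3
  exact (ENNReal.ofReal_le_ofReal_iff hε.le).1 h3

/-- A coherent frame has enough points in `x K C`. -/
lemma exists_le_encard_of_isFrame [CompleteSpace H] (hπ : IsProjectiveRep π) {d : ℝ}
    (hd : IsFormalDegree μ π d) (hg : g ≠ 0) (hfr : IsFrame (coherentSystem π Λ g))
    (htail : ∀ ε : ℝ, 0 < ε → ∃ C : Set G, IsCompact C ∧ C.Nonempty ∧ ∀ (y : G) (F : Finset Λ),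
      (∀ l ∈ F, y⁻¹ * l ∉ C) →
        ∑ l ∈ F, ‖inner ℂ (coherentSystem π Λ g l) (π y g)‖ ^ 2 ≤ ε)
    {ε : ℝ} (hε : 0 < ε) :
    ∃ C : Set G, IsCompact C ∧ C.Nonempty ∧ ∀ K : Set G, IsCompact K → ∀ x : G,
      ENNReal.ofReal (d * (1 - ε)) * μ K ≤ ((Λ ∩ x • (K * C)).encard : ℝ≥0∞) := by
  classical
  obtain ⟨A, ψ, hA, hdual⟩ := hfr.exists_dual
  have hgn : 0 < ‖g‖ ^ 2 := by positivity
  have hd0 := hd.1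
  obtain ⟨C, hC, hCne, hCt⟩ := htail (A * (ε * ‖g‖ ^ 2)) (by positivity)
  refine ⟨C, hC, hCne, fun K hK x => ?_⟩
  by_cases htop : ((Λ ∩ x • (K * C)).encard : ℝ≥0∞) = ∞
  · rw [htop]; exact le_top
  obtain ⟨F, hF, hcard⟩ := exists_finset_of_encard_ne_top htop
  rw [← hcard]
  set W := Submodule.span ℂ ((F.image ψ : Finset H) : Set H)
  have hrank : Module.finrank ℂ W ≤ F.card :=
    (finrank_span_finset_le_card _).trans Finset.card_image_le
  -- Indices outside `F` satisfy `y⁻¹ * l ∉ C`, so the dual reconstruction puts `π y g` within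
  -- squared distance `ε * ‖g‖ ^ 2` of `W`.
  have hpt : ∀ y ∈ x • K, ENNReal.ofReal (‖g‖ ^ 2 * (1 - ε)) ≤
      ENNReal.ofReal (‖W.starProjection (π y g)‖ ^ 2) := by
    intro y hy
    refine ENNReal.ofReal_le_ofReal ?_
    have h1 := hdual (π y g) F _ fun F' hdisj => hCt y F' fun l hl hlC => by
      refine Finset.disjoint_right.1 hdisj hl ((hF l).2 ?_)
      have := Set.mul_mem_mul hy hlC
      rwa [mul_inv_cancel_left, smul_mul_assoc] at this
    have h2 := le_of_mul_le_mul_left h1 hA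
    have hmem : ∑ i ∈ F, inner ℂ (coherentSystem π Λ g i) (π y g) • ψ i ∈ W :=
      Submodule.sum_mem _ fun i hi => Submodule.smul_mem _ _
        (Submodule.subset_span (by simpa using ⟨i, i.2, hi, rfl⟩))
    have h3 : ‖π y g - W.starProjection (π y g)‖ ≤
        ‖π y g - ∑ i ∈ F, inner ℂ (coherentSystem π Λ g i) (π y g) • ψ i‖ := by
      rw [W.starProjection_minimal]
      exact ciInf_le ⟨0, by rintro _ ⟨w, rfl⟩; positivity⟩ (⟨_, hmem⟩ : W)
    have h4 := W.norm_sq_eq_add_norm_sq_starProjection (π y g)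
    rw [Submodule.starProjection_orthogonal_val, LinearIsometryEquiv.norm_map] at h4
    have h5 := (pow_le_pow_left₀ (norm_nonneg _) h3 2).trans h2
    linarith
  have h1 : ENNReal.ofReal (‖g‖ ^ 2 * (1 - ε)) * μ K ≤
      F.card * ENNReal.ofReal (d⁻¹ * ‖g‖ ^ 2) := by
    calc ENNReal.ofReal (‖g‖ ^ 2 * (1 - ε)) * μ K
        = ∫⁻ y in x • K, ENNReal.ofReal (‖g‖ ^ 2 * (1 - ε)) ∂μ := by
          rw [setLIntegral_const, measure_smul]
      _ ≤ ∫⁻ y in x • K, ENNReal.ofReal (‖W.starProjection (π y g)‖ ^ 2) ∂μ :=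
          setLIntegral_mono' (hK.smul x).measurableSet hpt
      _ ≤ ∫⁻ y, ENNReal.ofReal (‖W.starProjection (π y g)‖ ^ 2) ∂μ :=
          setLIntegral_le_lintegral _ _
      _ = Module.finrank ℂ W * ENNReal.ofReal (d⁻¹ * ‖g‖ ^ 2) :=
          hd.lintegral_norm_sq_starProjection hπ g W
      _ ≤ _ := by gcongr
  have h2 : ENNReal.ofReal (d * (1 - ε)) * μ K =
      ENNReal.ofReal (d / ‖g‖ ^ 2) * (ENNReal.ofReal (‖g‖ ^ 2 * (1 - ε)) * μ K) := by
    rw [← mul_assoc, ← ENNReal.ofReal_mul (by positivity)]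
    congr 2
    field_simp
  have h3 : (F.card : ℝ≥0∞) =
      ENNReal.ofReal (d / ‖g‖ ^ 2) * (F.card * ENNReal.ofReal (d⁻¹ * ‖g‖ ^ 2)) := by
    rw [mul_left_comm, ← ENNReal.ofReal_mul (by positivity)]
    have : d / ‖g‖ ^ 2 * (d⁻¹ * ‖g‖ ^ 2) = 1 := by field_simp
    rw [this]; simp
  rw [h2, h3]
  gcongr

/-- A coherent Riesz basis does not have too many points in `x K`. -/
lemma exists_encard_le_of_isRieszBasis [CompleteSpace H] (hπ : IsProjectiveRep π) {d : ℝ}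
    (hd : IsFormalDegree μ π d) (hg : g ≠ 0) (hfr : IsRieszBasis (coherentSystem π Λ g))
    {ε : ℝ} (hε : 0 < ε) :
    ∃ C : Set G, IsCompact C ∧ C.Nonempty ∧ ∀ K : Set G, IsCompact K → ∀ x : G,
      ((Λ ∩ x • K).encard : ℝ≥0∞) ≤ ENNReal.ofReal (d * (1 + ε)) * μ (K * C) := by
  classical
  obtain ⟨A, hA, hli, hlow⟩ := hfr.exists_lower_bound
  have hgn : 0 < ‖g‖ ^ 2 := by positivity
  have hd0 := hd.1
  -- Chosen so that `d⁻¹ * ‖g‖ ^ 2 - δ = ‖g‖ ^ 2 / (d * (1 + ε))`.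
  set δ := ε / (1 + ε) * (d⁻¹ * ‖g‖ ^ 2) with hδ
  have hδ0 : 0 < δ := by positivity
  have hfin : ∫⁻ z, ENNReal.ofReal (‖coeff π g g z‖ ^ 2) ∂μ ≠ ∞ := by
    rw [hd.lintegral_coeff]; exact ENNReal.ofReal_ne_top
  obtain ⟨C, hC, hCne, hCint⟩ := exists_isCompact_setLIntegral_compl_le hfin
    (ε := ENNReal.ofReal (A * δ)) (by simpa using by positivity)
  refine ⟨C, hC, hCne, fun K hK x => encard_inter_le fun F hF => ?_⟩
  set W := Submodule.span ℂ (coherentSystem π Λ g '' F)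
  have hWfin : FiniteDimensional ℂ W := FiniteDimensional.span_of_finite ℂ (F.finite_toSet.image _)
  have hrank : Module.finrank ℂ W = F.card := by
    have h1 := finrank_span_eq_card (hli.comp (Subtype.val : F → Λ) Subtype.val_injective)
    rw [Set.range_comp, Subtype.range_coe_subtype, Fintype.card_coe] at h1
    exact h1
  set S := x • (K * C)
  have hS : IsCompact S := (hK.mul hC).smul x
  have hSm := hS.measurableSet
  have hin : ∫⁻ y in S, ENNReal.ofReal (‖W.starProjection (π y g)‖ ^ 2) ∂μ ≤
      ENNReal.ofReal (‖g‖ ^ 2) * μ (K * C) := by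
    rw [← measure_smul μ x (K * C), ← setLIntegral_const]
    refine setLIntegral_mono' hSm fun y _ => ENNReal.ofReal_le_ofReal ?_
    have := W.norm_starProjection_apply_le (π y g)
    rw [LinearIsometryEquiv.norm_map] at this
    gcongr
  -- For `l ∈ x • K` and `y ∉ x • (K * C)`, the point `l⁻¹ * y` lies outside `C`.
  have hterm : ∀ l ∈ F, ∫⁻ y in Sᶜ, ENNReal.ofReal (‖coeff π g g ((l : G)⁻¹ * y)‖ ^ 2) ∂μ ≤
      ENNReal.ofReal (A * δ) := by
    intro l hl
    refine le_trans (le_of_eq_of_le ?_ (lintegral_mono_set (μ := μ)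
      (s := (fun z => (l : G) * z) ⁻¹' Sᶜ) (t := Cᶜ)
      (f := fun z => ENNReal.ofReal (‖coeff π g g z‖ ^ 2)) ?_)) hCint
    · rw [← lintegral_indicator hSm.compl, ← lintegral_indicator
        ((measurable_const_mul (l : G)) hSm.compl), ← lintegral_mul_left_eq_self _ (l : G)]
      congr 1
      ext z
      simp [Set.indicator_apply]
    · intro z hz hzC
      refine hz ?_
      have := Set.mul_mem_mul (hF l hl) hzC
      rwa [smul_mul_assoc] at this
  have hout : ∫⁻ y in Sᶜ, ENNReal.ofReal (‖W.starProjection (π y g)‖ ^ 2) ∂μ ≤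
      F.card * ENNReal.ofReal δ := by
    have hpt : ∀ y, ENNReal.ofReal (‖W.starProjection (π y g)‖ ^ 2) ≤ ENNReal.ofReal A⁻¹ *
        ∑ l ∈ F, ENNReal.ofReal (‖coeff π g g ((l : G)⁻¹ * y)‖ ^ 2) := by
      intro y
      rw [← ENNReal.ofReal_sum_of_nonneg fun _ _ => by positivity,
        ← ENNReal.ofReal_mul (by positivity)]
      refine ENNReal.ofReal_le_ofReal ?_
      rw [← div_eq_inv_mul, le_div_iff₀ hA, mul_comm]
      refine (hlow F (π y g) (W.starProjection (π y g)) (W.starProjection_apply_mem _) ?_).trans_eq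
        (Finset.sum_congr rfl fun l _ => ?_)
      · have h1 := W.starProjection_inner_eq_zero (π y g) _ (W.starProjection_apply_mem (π y g))
        rw [inner_sub_left, sub_eq_zero] at h1
        rw [← inner_conj_symm, h1, inner_self_eq_norm_sq_to_K]
        simp
      · rw [norm_inner_symm, coherentSystem, hπ.norm_inner_apply_apply]
    calc ∫⁻ y in Sᶜ, ENNReal.ofReal (‖W.starProjection (π y g)‖ ^ 2) ∂μ
        ≤ ∫⁻ y in Sᶜ, ENNReal.ofReal A⁻¹ *
          ∑ l ∈ F, ENNReal.ofReal (‖coeff π g g ((l : G)⁻¹ * y)‖ ^ 2) ∂μ := lintegral_mono hpt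
      _ = ENNReal.ofReal A⁻¹ * ∑ l ∈ F, ∫⁻ y in Sᶜ,
          ENNReal.ofReal (‖coeff π g g ((l : G)⁻¹ * y)‖ ^ 2) ∂μ := by
          have hm : ∀ l : Λ, Measurable fun y =>
              ENNReal.ofReal (‖coeff π g g ((l : G)⁻¹ * y)‖ ^ 2) := fun l =>
            ((((hπ.stronglyMeasurable_coeff g g).norm.measurable.pow_const 2).ennreal_ofReal).comp
              (measurable_const_mul ((l : G)⁻¹)))
          rw [lintegral_const_mul _ (Finset.measurable_sum _ fun l _ => hm l),
            lintegral_finsetSum _ fun l _ => hm l]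
      _ ≤ ENNReal.ofReal A⁻¹ * ∑ l ∈ F, ENNReal.ofReal (A * δ) := by
          gcongr with l hl
          exact hterm l hl
      _ = F.card * ENNReal.ofReal δ := by
          rw [Finset.sum_const, nsmul_eq_mul, mul_left_comm, ← ENNReal.ofReal_mul (by positivity),
            inv_mul_cancel_left₀ hA.ne']
  have htot := hd.lintegral_norm_sq_starProjection hπ g W
  rw [← lintegral_add_compl _ hSm, hrank] at htot
  have h1 : F.card * ENNReal.ofReal (d⁻¹ * ‖g‖ ^ 2) ≤
      ENNReal.ofReal (‖g‖ ^ 2) * μ (K * C) + F.card * ENNReal.ofReal δ := by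
    rw [← htot]; exact add_le_add hin hout
  have hKCt : μ (K * C) ≠ ∞ := (hK.mul hC).measure_ne_top
  rw [← ENNReal.ofReal_toReal hKCt, ← ENNReal.ofReal_natCast,
    ← ENNReal.ofReal_mul (by positivity)]
  rw [← ENNReal.ofReal_toReal hKCt, ← ENNReal.ofReal_natCast,
    ← ENNReal.ofReal_mul (by positivity), ← ENNReal.ofReal_mul (by positivity),
    ← ENNReal.ofReal_mul (by positivity), ← ENNReal.ofReal_add (by positivity) (by positivity),
    ENNReal.ofReal_le_ofReal_iff (by positivity)] at h1
  refine ENNReal.ofReal_le_ofReal ?_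
  set m := (μ (K * C)).toReal
  have h2 : (F.card : ℝ) * (d⁻¹ * ‖g‖ ^ 2) - F.card * δ =
      F.card * (‖g‖ ^ 2 / (d * (1 + ε))) := by
    rw [hδ]; field_simp; ring
  have h3 : (F.card : ℝ) * (‖g‖ ^ 2 / (d * (1 + ε))) ≤ ‖g‖ ^ 2 * m := by linarith
  rw [mul_div_assoc', div_le_iff₀ (by positivity)] at h3
  refine le_of_mul_le_mul_right (h3.trans_eq ?_) hgn
  ring

end Coherent

end CoherentFrames

/-! ### The density theorem. -/

theorem corollary3p4
    {G : Type*} [Group G] [TopologicalSpace G] [IsTopologicalGroup G] [T2Space G]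
    [LocallyCompactSpace G] [SecondCountableTopology G] [MeasurableSpace G] [BorelSpace G]
    (μ : Measure G) [μ.IsHaarMeasure] [μ.IsMulRightInvariant]
    (hG : CoherentFrames.IsAmenable μ)
    (Q : Set G) (hQ_compact : IsCompact Q) (hQ_symm : Q⁻¹ = Q) (hQ_nhds : Q ∈ 𝓝 (1 : G))
    {H : Type*} [NormedAddCommGroup H] [InnerProductSpace ℂ H] [CompleteSpace H]
    (π : G → H ≃ₗᵢ[ℂ] H) (hπ : CoherentFrames.IsDiscreteSeries μ π) :
    ∃ d : ℝ, CoherentFrames.IsFormalDegree μ π d ∧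
      ∀ Λ : Set G, DiscreteTopology Λ → ∀ g ∈ CoherentFrames.B2 μ Q π,
        (CoherentFrames.IsFrame (CoherentFrames.coherentSystem π Λ g) →
          ∃ D : ℝ≥0∞, CoherentFrames.HasLowerBeurlingDensity μ Λ D ∧ ENNReal.ofReal d ≤ D) ∧
        (CoherentFrames.IsRieszBasis (CoherentFrames.coherentSystem π Λ g) →
          CoherentFrames.HasUpperBeurlingDensity μ Λ (ENNReal.ofReal d)) := by
  have := CoherentFrames.isInvInvariant_of_unimodular μ
  obtain ⟨d, hd⟩ := hπ.exists_formalDegree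
  have hp := hπ.toIsProjectiveRep
  refine ⟨d, hd, fun Λ _ g hgB => ?_⟩
  have hg : CoherentFrames.IsFrame (CoherentFrames.coherentSystem π Λ g) → g ≠ 0 := by
    rintro ⟨A, B, hA, hB, hfr⟩ rfl
    obtain ⟨f, hf, -⟩ := hπ.squareIntegrable
    have h := (hfr f).2.1
    simp only [CoherentFrames.coherentSystem, map_zero, inner_zero_left, norm_zero] at h
    have : 0 < A * ‖f‖ ^ 2 := by positivity
    simp at h
    linarith
  have hlower : CoherentFrames.IsFrame (CoherentFrames.coherentSystem π Λ g) →
      ∃ D : ℝ≥0∞, CoherentFrames.HasLowerBeurlingDensity μ Λ D ∧ ENNReal.ofReal d ≤ D := by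
    intro hfr
    obtain ⟨V, R, hV, hV1, hsymm, hVQ, hRtop, hR⟩ :=
      CoherentFrames.exists_overlap_bound hp (hg hfr) hQ_nhds μ hfr
    have hVQ' := hVQ.trans interior_subset
    have hV0 : μ V ≠ 0 := (hV.measure_pos μ ⟨1, hV1⟩).ne'
    have hVtop : μ V ≠ ∞ := ((measure_mono hVQ').trans_lt hQ_compact.measure_lt_top).ne
    refine ⟨CoherentFrames.lowerDensity μ Λ,
      CoherentFrames.hasLowerBeurlingDensity_lowerDensity hQ_compact hVQ'
        (ENNReal.div_ne_top hRtop hV0)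
        (CoherentFrames.encard_inter_le_of_overlap hV hsymm hR hV0 hVtop),
      CoherentFrames.le_lowerDensity hG fun ε hε _ =>
        CoherentFrames.exists_le_encard_of_isFrame hp hd (hg hfr) hfr (fun η hη =>
          CoherentFrames.exists_sum_tail_le hp hQ_compact hV hV1 hsymm hVQ hRtop hR hgB hη) hε⟩
  exact ⟨hlower, fun hfr => CoherentFrames.hasUpperBeurlingDensity_of_le (hlower hfr.1)
    fun ε hε _ => CoherentFrames.exists_encard_le_of_isRieszBasis hp hd (hg hfr.1) hfr hε⟩
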